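/- Let $G$ be a connected (finite-dimensional) complex Lie group with Lie algebra $\mathfrak g$. Write $x\wedge y=x\otimes y-y\otimes x$. Quasitriangular r-matrices. Let $s\in (S^2\mathfrak g)^{\mathfrak g}$ be an invariant symmetric element of $\mathfrak g\otimes\mathfrak g$ and $\Lambda\in\wedge^2\mathfrak g$. The element $r=s+\Lambda$ is a quasitriangular r-matrix if $[\Lambda,\Lambda]+\phi_s=0$, where $[\,,]$ is the Schouten bracket and $\phi_s(\xi,\eta,\zeta)=2\langle \xi,[s^\sharp\eta,s^\sharp\zeta]\rangle$ for $\xi,\eta,\zeta\in\mathfrak g^*$, with $\langle s^\sharp \xi,\eta\rangle=s(\xi,\eta)$. For a finite linearly ordered set $J$, a sign function $\varepsilon:J\to\{1,-1\}$ and $r=s+\Lambda=\sum_i x_i\otimes y_i$, put $$r^{(\varepsilon,J)}=\sum_{j\in J}(\varepsilon(j)s+\Lambda)_j-\sum_{j<k}\sum_i (y_i)_j\wedge (x_i)_k\ \in\ \mathfrak g^J\otimes\mathfrak g^J,$$ where $(\cdot)_j$ denotes the embedding as the $j$-th component. Graphs. Let $\Gamma$ be a finite graph with vertex set $V$ and edge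 set $\Gamma_1$ (loops, multiple edges and isolated vertices allowed), with an orientation of each edge and, for each $v\in V$, a linear order on the set $\Gamma_v$ of half edges incident to $v$; that is, an oriented ciliated graph. For example, $\Gamma$ may be any oriented skeleton of a marked surface $(\Sigma,V)$, that is, of a compact oriented surface $\Sigma$ with a non-empty finite set $V\subset\partial\Sigma$, where a skeleton is an embedded graph with vertex set $V$ onto which $\Sigma$ deformation retracts; the linear orders are then those induced by the orientation of $\Sigma$. Let $\Gamma_{1/2}=\bigsqcup_{v}\Gamma_v$ be the set of half edges; for $\gamma\in\Gamma_1$ let $\alpha_\gamma$ and $\check\alpha_\gamma$ be its source and end half edges. Let $\varepsilon_v:\Gamma_v\to\{1,-1\}$ be $1$ on source half edges and $-1$ on end half edges. Theorem. For every $v\in V$ let $r_v=s+\Lambda_v$ be a quasitriangular r-matrix on $\mathfrak g$, all with the same symmetric part $s$. Let $$r_\Gamma=\sum_{v\in V}\big(r_v^{(\varepsilon_v,\Gamma_v)}\big)_v\in\mathfrak g^{\Gamma_{1/2}}\otimes\mathfrak g^{\Gamma_{1/2}},$$ and let $\sigma_\Gamma:\mathfrak g^{\Gamma_{1/2}}\to\mathfrak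 X^1(G^{\Gamma_1})$ be the infinitesimal action of the right action of $G^{\Gamma_{1/2}}$ on $G^{\Gamma_1}$ given by $(g\cdot h)_\gamma=h_{\alpha_\gamma}^{-1}\,g_\gamma\, h_{\check\alpha_\gamma}$. Then the 2-tensor field $\pi_\Gamma=\sigma_\Gamma(r_\Gamma)$ is a holomorphic bivector field (that is, antisymmetric) and is a Poisson structure on $G^{\Gamma_1}$: the bracket $\{f_1,f_2\}=\pi_\Gamma(df_1,df_2)$ on locally defined holomorphic functions satisfies the Jacobi identity. -/

import Mathlib

open scoped TensorProduct Manifold ContDiff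

noncomputable section

/-! ### Quasitriangular r-matrices

Throughout, `⋀² L` and `⋀³ L` are realised as the spaces of antisymmetric tensors in `L ⊗ L` and
`L ⊗ (L ⊗ L)`, with `x ∧ y = x ⊗ y - y ⊗ x` and
`x ∧ y ∧ z = ∑ over permutations, with sign, of x ⊗ y ⊗ z`. -/

namespace RMatrix

section LieAlgebra

variable {𝕜 L : Type*} [Field 𝕜] [LieRing L] [LieAlgebra 𝕜 L]

/-- The linear map `L ⊗ (L ⊗ L) → L ⊗ (L ⊗ L)` with `x ⊗ (y ⊗ z) ↦ x ∧ y ∧ z`. -/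
def wedge₃ : L ⊗[𝕜] (L ⊗[𝕜] L) →ₗ[𝕜] L ⊗[𝕜] (L ⊗[𝕜] L) :=
  -- `x ⊗ (y ⊗ z) ↦ x ⊗ (z ⊗ y)`
  let τ : L ⊗[𝕜] (L ⊗[𝕜] L) →ₗ[𝕜] L ⊗[𝕜] (L ⊗[𝕜] L) :=
    LinearMap.lTensor L (TensorProduct.comm 𝕜 L L).toLinearMap
  -- `x ⊗ (y ⊗ z) ↦ y ⊗ (z ⊗ x)`
  let c : L ⊗[𝕜] (L ⊗[𝕜] L) →ₗ[𝕜] L ⊗[𝕜] (L ⊗[𝕜] L) :=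
    (TensorProduct.assoc 𝕜 L L L).toLinearMap ∘ₗ
      (TensorProduct.comm 𝕜 L (L ⊗[𝕜] L)).toLinearMap
  (LinearMap.id + c + c ∘ₗ c) ∘ₗ (LinearMap.id - τ)

/-- The Lie bracket as a linear map `L ⊗ L → L`. -/
def lieMap : L ⊗[𝕜] L →ₗ[𝕜] L :=
  (LieModule.toModuleHom 𝕜 L L : L ⊗[𝕜] L →ₗ[𝕜] L)

/-- The Schouten bracket `⋀² L × ⋀² L → ⋀³ L`: for antisymmetric tensors `Λ = ∑ a ⊗ b` and
`Λ' = ∑ c ⊗ d`, it is `[Λ, Λ'] = ∑ ∑ [a, c] ∧ b ∧ d`. On decomposable elements this reads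
`[a ∧ b, c ∧ d] = [a, c] ∧ b ∧ d - [a, d] ∧ b ∧ c - [b, c] ∧ a ∧ d + [b, d] ∧ a ∧ c`. -/
def schouten (Λ Λ' : L ⊗[𝕜] L) : L ⊗[𝕜] (L ⊗[𝕜] L) :=
  wedge₃ (LinearMap.rTensor (L ⊗[𝕜] L) lieMap
    (TensorProduct.tensorTensorTensorComm 𝕜 L L L L (Λ ⊗ₜ[𝕜] Λ')))

/-- The value `t(ξ, η, ζ)` of a 3-tensor on three linear forms. -/
def eval₃ (t : L ⊗[𝕜] (L ⊗[𝕜] L)) (ξ η ζ : Module.Dual 𝕜 L) : 𝕜 :=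
  LinearMap.mul' 𝕜 𝕜 (TensorProduct.map ξ (LinearMap.mul' 𝕜 𝕜 ∘ₗ TensorProduct.map η ζ) t)

/-- For `s = ∑ a ⊗ b` and a linear form `ξ`, the vector `s♯(ξ) = ∑ ξ(a) b`, that is
`⟨s♯(ξ), η⟩ = s(ξ, η)`. -/
def sharp (s : L ⊗[𝕜] L) (ξ : Module.Dual 𝕜 L) : L :=
  TensorProduct.lid 𝕜 L (LinearMap.rTensor L ξ s)

/-- `φ_s(ξ, η, ζ) = 2 ⟨ξ, [s♯(η), s♯(ζ)]⟩`. -/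
def cartanForm (s : L ⊗[𝕜] L) (ξ η ζ : Module.Dual 𝕜 L) : 𝕜 :=
  2 * ξ ⁅sharp s η, sharp s ζ⁆

/-- `r = s + Λ` is a quasitriangular r-matrix on `L`, with `s ∈ (S² L)^L` and `Λ ∈ ⋀² L`. -/
structure IsQuasitriangular (s Λ : L ⊗[𝕜] L) : Prop where
  symm : TensorProduct.comm 𝕜 L L s = s
  /-- `s` is invariant: `∑ [x, a] ⊗ b + a ⊗ [x, b] = 0` for `s = ∑ a ⊗ b`. -/
  invariant : ∀ x : L, ⁅x, s⁆ = 0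
  skew : TensorProduct.comm 𝕜 L L Λ = -Λ
  /-- The classical Yang–Baxter equation `[Λ, Λ] + φ_s = 0`. -/
  yangBaxter : ∀ ξ η ζ : Module.Dual 𝕜 L,
    eval₃ (schouten Λ Λ) ξ η ζ + cartanForm s ξ η ζ = 0

end LieAlgebra

section Polyuble

variable {𝕜 L : Type*} [Field 𝕜] [AddCommGroup L] [Module 𝕜 L]

/-- For `j ∈ J` and `t ∈ L ⊗ L`, the element `(t)_j` of `L^J ⊗ L^J`. -/
def at₂ {J : Type*} [DecidableEq J] (j : J) (t : L ⊗[𝕜] L) : (J → L) ⊗[𝕜] (J → L) :=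
  TensorProduct.map (LinearMap.single 𝕜 (fun _ => L) j) (LinearMap.single 𝕜 (fun _ => L) j) t

/-- For `r = ∑ x ⊗ y`, the element
`∑ (y)_j ∧ (x)_k = ∑ (y)_j ⊗ (x)_k - (x)_k ⊗ (y)_j` of `⋀² (L^J)`. -/
def mixAt {J : Type*} [DecidableEq J] (r : L ⊗[𝕜] L) (j k : J) : (J → L) ⊗[𝕜] (J → L) :=
  TensorProduct.map (LinearMap.single 𝕜 (fun _ => L) j) (LinearMap.single 𝕜 (fun _ => L) k)
      (TensorProduct.comm 𝕜 L L r) -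
    TensorProduct.map (LinearMap.single 𝕜 (fun _ => L) k) (LinearMap.single 𝕜 (fun _ => L) j) r

/-- `Mix^J(r) = ∑_{j < k} Mix^J(r)_{j,k}` for a finite linearly ordered set `J`. -/
def mix (J : Type*) [Fintype J] [LinearOrder J] (r : L ⊗[𝕜] L) : (J → L) ⊗[𝕜] (J → L) :=
  ∑ j : J, ∑ k : J with j < k, mixAt r j k

/-- For `r = s + Λ` and a sign function `ε` on a finite linearly ordered set `J`, the element
`r^{(ε, J)} = ∑_j (ε(j) s + Λ)_j - Mix^J(r)` of `L^J ⊗ L^J`. -/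
def polyuble (J : Type*) [Fintype J] [LinearOrder J] (ε : J → ℤˣ) (s Λ : L ⊗[𝕜] L) :
    (J → L) ⊗[𝕜] (J → L) :=
  ∑ j : J, at₂ j (((ε j : ℤ) : 𝕜) • s + Λ) - mix J (s + Λ)

end Polyuble

end RMatrix

/-! ### Oriented ciliated graphs -/

/-- The half edges of a graph with set of oriented edges `Edge`: each edge `γ` has a source half
edge `Sum.inl γ` and an end half edge `Sum.inr γ`. -/
abbrev HalfEdge (Edge : Type*) : Type _ := Edge ⊕ Edge

/-- A graph (loops, multiple edges and isolated vertices are allowed) with oriented edges, in which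
each vertex is equipped with a linear order of the half edges incident to it. -/
structure OrientedCiliatedGraph (V Edge : Type*) where
  source : Edge → V
  target : Edge → V
  /-- The linear order on the set of half edges incident to `v`. -/
  order : ∀ v : V, LinearOrder {α : HalfEdge Edge // Sum.elim source target α = v}

namespace OrientedCiliatedGraph

variable {V Edge : Type*} (Γ : OrientedCiliatedGraph V Edge)

/-- The set `Γ_v` of half edges incident to the vertex `v`. -/
abbrev Star (v : V) : Type _ :=
  {α : HalfEdge Edge // Sum.elim Γ.source Γ.target α = v}

/-- `ε_v(α) = 1` if `α` is a source half edge, and `-1` if `α` is an end half edge. -/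
def sign (v : V) (α : Γ.Star v) : ℤˣ :=
  Sum.elim (fun _ => 1) (fun _ => -1) α.1

variable [Fintype V] [DecidableEq V] [Fintype Edge] [DecidableEq Edge]
variable {𝕜 L : Type*} [Field 𝕜] [AddCommGroup L] [Module 𝕜 L]

/-- The inclusion of `L^{Γ_v}` as a direct summand of `L^{Γ_{1/2}}` (extension by zero). -/
def inclusion (v : V) : (Γ.Star v → L) →ₗ[𝕜] (HalfEdge Edge → L) :=
  ∑ α : Γ.Star v, LinearMap.single 𝕜 (fun _ : HalfEdge Edge => L) α.1 ∘ₗ LinearMap.proj α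

/-- `r_Γ = ∑_v (r_v^{(ε_v, Γ_v)})_v`, where `r_v = s + Λ_v`. -/
def rMatrix (s : L ⊗[𝕜] L) (Λ : V → L ⊗[𝕜] L) :
    (HalfEdge Edge → L) ⊗[𝕜] (HalfEdge Edge → L) :=
  ∑ v : V,
    letI := Γ.order v
    TensorProduct.map (Γ.inclusion v) (Γ.inclusion v)
      (RMatrix.polyuble (Γ.Star v) (Γ.sign v) s (Λ v))

end OrientedCiliatedGraph

/-! ### Poisson structures on complex manifolds -/

section Poisson

variable {E : Type*} [NormedAddCommGroup E] [NormedSpace ℂ E] {H : Type*} [TopologicalSpace H]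
  (I : ModelWithCorners ℂ E H) {M : Type*} [TopologicalSpace M] [ChartedSpace H M]

/-- The differential at `x` of a complex-valued function, as a linear form on the tangent space. -/
def differential (f : M → ℂ) (x : M) : TangentSpace I x →ₗ[ℂ] ℂ :=
  (NormedSpace.fromTangentSpace (f x)).toLinearMap ∘ₗ
    (mfderiv I 𝓘(ℂ, ℂ) f x).toLinearMap

/-- The bracket `{f, g} = π(df, dg)` defined by a 2-tensor field `π`. -/
def tensorBracket (π : ∀ x : M, TangentSpace I x ⊗[ℂ] TangentSpace I x) (f g : M → ℂ) (x : M) : ℂ :=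
  LinearMap.mul' ℂ ℂ (TensorProduct.map (differential I f x) (differential I g x) (π x))

/-- A 2-tensor field `π` on a complex manifold is a Poisson structure: it is a holomorphic bivector
field whose bracket `{f, g} = π(df, dg)` on locally defined holomorphic functions satisfies the
Jacobi identity. Holomorphy of `π` is expressed by saying that `π(df, dg)` is holomorphic whenever
`f` and `g` are holomorphic functions on an open set. -/
structure IsPoissonStructure (π : ∀ x : M, TangentSpace I x ⊗[ℂ] TangentSpace I x) : Prop where
  skew : ∀ x, TensorProduct.comm ℂ (TangentSpace I x) (TangentSpace I x) (π x) = -π x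
  holomorphic : ∀ U : Set M, IsOpen U → ∀ f g : M → ℂ,
    ContMDiffOn I 𝓘(ℂ, ℂ) ω f U → ContMDiffOn I 𝓘(ℂ, ℂ) ω g U →
    ContMDiffOn I 𝓘(ℂ, ℂ) ω (tensorBracket I π f g) U
  jacobi : ∀ U : Set M, IsOpen U → ∀ f g h : M → ℂ,
    ContMDiffOn I 𝓘(ℂ, ℂ) ω f U → ContMDiffOn I 𝓘(ℂ, ℂ) ω g U →
    ContMDiffOn I 𝓘(ℂ, ℂ) ω h U → ∀ x ∈ U,
    tensorBracket I π f (tensorBracket I π g h) x +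
      tensorBracket I π g (tensorBracket I π h f) x +
      tensorBracket I π h (tensorBracket I π f g) x = 0

end Poisson

/-! ### The action by half-edge gauge transformations -/

section Gauge

variable {E : Type*} [NormedAddCommGroup E] [NormedSpace ℂ E]

/-- The model of the product manifold `G^J`, for `G` a complex manifold modelled on `E`. -/
abbrev powModel (E : Type*) [NormedAddCommGroup E] [NormedSpace ℂ E] (J : Type*) [Fintype J] :
    ModelWithCorners ℂ (J → E) (ModelPi fun _ : J => E) :=
  ModelWithCorners.pi fun _ : J => 𝓘(ℂ, E)

instance completeSpace_of_finiteDimensional_complex [FiniteDimensional ℂ E] : CompleteSpace E :=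
  FiniteDimensional.complete ℂ E

variable (E) (G : Type*) [TopologicalSpace G] [ChartedSpace E G] [Group G]

/-- The Lie algebra of `G`. -/
abbrev LieAlg : Type _ := GroupLieAlgebra 𝓘(ℂ, E) G

variable {V Edge : Type*} [Fintype Edge]

/-- The right action of `G^{Γ_{1/2}}` on `G^{Γ_1}`: `(g · h)_γ = h_α⁻¹ g_γ h_{α'}`, where `α` and
`α'` are the source and end half edges of `γ`. -/
def gaugeAction {G Edge : Type*} [Group G] (g : Edge → G) (h : HalfEdge Edge → G) : Edge → G :=
  fun γ => (h (Sum.inl γ))⁻¹ * g γ * h (Sum.inr γ)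

/-- The identification of `𝔤^J` with the tangent space at the identity of the group `G^J`. -/
def powLieAlg (J : Type*) [Fintype J] :
    (J → LieAlg E G) →ₗ[ℂ] TangentSpace (powModel E J) (1 : J → G) where
  toFun x := x
  map_add' _ _ := rfl
  map_smul' _ _ := rfl

/-- The infinitesimal action `σ_Γ : 𝔤^{Γ_{1/2}} → 𝔛¹(G^{Γ_1})`: the value at `g` of the vector field
associated to `x` is the derivative at the identity, in the direction `x`, of
`h ↦ gaugeAction g h`. (In Mathlib tangent vectors at `gaugeAction g 1` and at `g` have the same
type, and `gaugeAction g 1 = g`.) -/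
def gaugeField (g : Edge → G) :
    (HalfEdge Edge → LieAlg E G) →ₗ[ℂ] TangentSpace (powModel E Edge) g :=
  (mfderiv (powModel E (HalfEdge Edge)) (powModel E Edge)
    (gaugeAction g) (1 : HalfEdge Edge → G)).toLinearMap ∘ₗ powLieAlg E G (HalfEdge Edge)

/-- The 2-tensor field `σ_Γ(r) = ∑ σ_Γ(x) ⊗ σ_Γ(y)` for `r = ∑ x ⊗ y`. -/
def gaugeTensor (r : (HalfEdge Edge → LieAlg E G) ⊗[ℂ] (HalfEdge Edge → LieAlg E G))
    (g : Edge → G) :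
    TangentSpace (powModel E Edge) g ⊗[ℂ] TangentSpace (powModel E Edge) g :=
  TensorProduct.map (gaugeField E G g) (gaugeField E G g) r

end Gauge

end

/-! Two facts carry the proof. First, `r_Γ` solves the classical Yang–Baxter equation `[r₁₂,r₁₃] +
[r₁₂,r₂₃] + [r₁₃,r₂₃] = 0` in the Lie algebra `𝔤^{Γ_{1/2}}`. Second, although `r_Γ` is not
antisymmetric, its image under the gauge action is. A Lie algebra action by derivations sends a
Yang–Baxter solution with skew image to a bracket satisfying Jacobi (`jacobi_of_yangBaxterForm`).

Yang–Baxter: distinct vertices occupy commuting summands, so one vertex suffices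
(`yangBaxterForm_rMatrix`). There the `(j,k)` block of `r^{(ε,J)}` is `Λ ± s`, with sign `-1` for `j
< k`, `+1` for `k < j` and `ε(j)` on the diagonal (`polyuble_eq_sum`). The equation splits into
triples of slots. By invariance of `s` the mixed `s`–`Λ` terms cancel and each triple reduces to `ab
- ac + bc = 1` for its three signs; this amounts to transitivity of the order (`yangBaxter_signs`,
`polyubleSign_trans`).

Antisymmetry: the symmetric part of `r_Γ` is `s` at each source half edge minus `s` at each end half
edge (`rMatrix_add_comm`). On the edge `γ`, an end half edge acts as minus the source half edge
precomposed with `Ad(g_γ)`. Since `G` is connected, `s` is `Ad`-invariant (`map_Ad_of_invariant`),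
so the two contributions cancel (`gaugeTensor_source_eq_target`).

The analysis supplies what these arguments presuppose: in a chart at the identity, the bracket of
left-invariant fields is computed from the group law, `d Ad = ad` is derived, and the gauge action
is shown to be a Lie algebra action on holomorphic functions (`gaugeDeriv_lie`). -/

namespace RMatrix

/-! ### Contractions of 2-tensors and the Schouten bracket. -/

section LieAlgebra

variable {𝕜 L : Type*} [Field 𝕜] [LieRing L] [LieAlgebra 𝕜 L]

@[simp]
theorem sharp_tmul (a b : L) (ξ : Module.Dual 𝕜 L) : sharp (a ⊗ₜ[𝕜] b) ξ = ξ a • b := by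
  simp [sharp]

@[simp]
theorem sharp_zero (ξ : Module.Dual 𝕜 L) : sharp (0 : L ⊗[𝕜] L) ξ = 0 := by
  simp [sharp]

theorem sharp_add (s t : L ⊗[𝕜] L) (ξ : Module.Dual 𝕜 L) :
    sharp (s + t) ξ = sharp s ξ + sharp t ξ := by
  simp [sharp]

theorem sharp_neg (s : L ⊗[𝕜] L) (ξ : Module.Dual 𝕜 L) : sharp (-s) ξ = -sharp s ξ := by
  simp [sharp]

theorem sharp_smul (c : 𝕜) (s : L ⊗[𝕜] L) (ξ : Module.Dual 𝕜 L) :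
    sharp (c • s) ξ = c • sharp s ξ := by
  simp [sharp]

theorem apply_sharp_lie (x : L) (s : L ⊗[𝕜] L) (ξ η : Module.Dual 𝕜 L) :
    η (sharp ⁅x, s⁆ ξ) =
      ξ ⁅x, sharp (TensorProduct.comm 𝕜 L L s) η⁆ + η ⁅x, sharp s ξ⁆ := by
  induction s with
  | zero => simp
  | tmul a b => simp [TensorProduct.LieModule.lie_tmul_right, sharp_add, mul_comm]
  | add s t hs ht => simp only [lie_add, sharp_add, map_add, hs, ht]; ring

/-- The Schouten bracket brackets first legs, so linear forms are fed to the second legs, hence the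
flips in `p` and `q`. The six terms are the signed permutations in `wedge₃`. -/
theorem eval₃_schouten (Λ Λ' : L ⊗[𝕜] L) (ξ η ζ : Module.Dual 𝕜 L) :
    let p := fun θ => sharp (TensorProduct.comm 𝕜 L L Λ) θ
    let q := fun θ => sharp (TensorProduct.comm 𝕜 L L Λ') θ
    eval₃ (schouten Λ Λ') ξ η ζ =
      ξ ⁅p η, q ζ⁆ - ξ ⁅p ζ, q η⁆ + ζ ⁅p ξ, q η⁆ - ζ ⁅p η, q ξ⁆ + η ⁅p ζ, q ξ⁆
        - η ⁅p ξ, q ζ⁆ := by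
  intro p q
  induction Λ with
  | zero => simp [p, schouten, eval₃]
  | add s t hs ht =>
    have h : schouten (s + t) Λ' = schouten s Λ' + schouten t Λ' := by
      simp [schouten, TensorProduct.add_tmul]
    have h' : eval₃ (schouten (s + t) Λ') ξ η ζ =
        eval₃ (schouten s Λ') ξ η ζ + eval₃ (schouten t Λ') ξ η ζ := by
      simp [h, eval₃]
    simp only [h', hs, ht, p, sharp_add, map_add, add_lie]
    ring
  | tmul a b =>
    induction Λ' with
    | zero => simp [q, schouten, eval₃]
    | add s t hs ht =>
      have h : schouten (a ⊗ₜ b) (s + t) = schouten (a ⊗ₜ b) s + schouten (a ⊗ₜ b) t := by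
        simp [schouten, TensorProduct.tmul_add]
      have h' : eval₃ (schouten (a ⊗ₜ b) (s + t)) ξ η ζ =
          eval₃ (schouten (a ⊗ₜ b) s) ξ η ζ + eval₃ (schouten (a ⊗ₜ b) t) ξ η ζ := by
        simp [h, eval₃]
      simp only [h', hs, ht, p, q, sharp_add, map_add, lie_add]
      ring
    | tmul c d =>
      simp [p, q, schouten, eval₃, wedge₃, lieMap]
      ring

end LieAlgebra

/-! ### The Yang–Baxter identity with signs. -/

section YangBaxter

variable {𝕜 L : Type*} [Field 𝕜] [LieRing L] [LieAlgebra 𝕜 L]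

/-- The Yang–Baxter identity for `Λ + a s`, `Λ + b s` and `Λ + c s` in the three pairs of tensor
factors; `P` and `Q` play the role of the contractions with `s` and `Λ`. -/
theorem yangBaxter_signs {P Q : Module.Dual 𝕜 L → L}
    (hinv : ∀ (x : L) (ξ η : Module.Dual 𝕜 L), ξ ⁅x, P η⁆ + η ⁅x, P ξ⁆ = 0)
    (hyb : ∀ ξ η ζ : Module.Dual 𝕜 L,
      ξ ⁅Q η, Q ζ⁆ - η ⁅Q ξ, Q ζ⁆ + ζ ⁅Q ξ, Q η⁆ + ξ ⁅P η, P ζ⁆ = 0)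
    {a b c : ℤˣ} (habc : a = c → b = a) (ξ η ζ : Module.Dual 𝕜 L) :
    ξ ⁅-Q η + ((a : ℤ) : 𝕜) • P η, -Q ζ + ((b : ℤ) : 𝕜) • P ζ⁆ +
      η ⁅Q ξ + ((a : ℤ) : 𝕜) • P ξ, -Q ζ + ((c : ℤ) : 𝕜) • P ζ⁆ +
      ζ ⁅Q ξ + ((b : ℤ) : 𝕜) • P ξ, Q η + ((c : ℤ) : 𝕜) • P η⁆ = 0 := by
  -- For signs, the left side is `1` when `a = -c`, and `2ab - 1` when `a = c`; hence the hypothesis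
  -- `habc`.
  have key : (a : ℤ) * b - a * c + b * c = 1 := by
    rcases Int.units_eq_one_or a with rfl | rfl <;> rcases Int.units_eq_one_or b with rfl | rfl <;>
      rcases Int.units_eq_one_or c with rfl | rfl <;> simp_all
  have key' : ((a : ℤ) : 𝕜) * (b : ℤ) - (a : ℤ) * (c : ℤ) + (b : ℤ) * (c : ℤ) = 1 := by
    exact_mod_cast congrArg (Int.cast (R := 𝕜)) key
  generalize ((a : ℤ) : 𝕜) = a at *
  generalize ((b : ℤ) : 𝕜) = b at *
  generalize ((c : ℤ) : 𝕜) = c at *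
  have sk : ∀ (θ : Module.Dual 𝕜 L) x y, θ ⁅x, y⁆ = -θ ⁅y, x⁆ := fun θ x y => by
    rw [← lie_skew, map_neg]
  clear key habc
  simp only [add_lie, lie_add, smul_lie, lie_smul, neg_lie, lie_neg, map_add, map_neg, map_smul,
    smul_eq_mul]
  have h1 := hinv (Q ζ) ξ η
  have h2 := hinv (Q η) ξ ζ
  have h3 := hinv (Q ξ) η ζ
  have h4 := hinv (P ζ) ξ η
  have h5 := hinv (P ξ) η ζ
  have h6 := hyb ξ η ζ
  rw [sk ξ (P η) (Q ζ), sk η (P ξ) (Q ζ), sk ζ (P ξ) (Q η)]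
  rw [sk ξ (P ζ) (P η)] at h4
  rw [sk η (P ζ) (P ξ)] at h4
  -- `h1`–`h3` cancel the mixed terms. `h4` and `h5` bring all `P`–`P` terms to `ξ ⁅P η, P ζ⁆` with
  -- coefficient `ab - ac + bc`, which `key'` matches with the coefficient `1` in `h6`.
  linear_combination a * h1 - b * h2 + c * h3 + h6 + (ξ ⁅P η, P ζ⁆) * key' + (-a * c + b * c) * h4 + b * c * h5

/-- For equal arguments the six terms of the Schouten bracket coincide in pairs; the resulting
factor 2, also present in `cartanForm`, is cancelled. -/
theorem IsQuasitriangular.yangBaxter_sharp [CharZero 𝕜] {s Λ : L ⊗[𝕜] L}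
    (h : IsQuasitriangular s Λ) (ξ η ζ : Module.Dual 𝕜 L) :
    ξ ⁅sharp Λ η, sharp Λ ζ⁆ - η ⁅sharp Λ ξ, sharp Λ ζ⁆ + ζ ⁅sharp Λ ξ, sharp Λ η⁆ +
      ξ ⁅sharp s η, sharp s ζ⁆ = 0 := by
  have h1 := h.yangBaxter ξ η ζ
  have sk : ∀ (θ : Module.Dual 𝕜 L) x y, θ ⁅x, y⁆ = -θ ⁅y, x⁆ := fun θ x y => by
    rw [← lie_skew, map_neg]
  simp only [eval₃_schouten, h.skew, sharp_neg, neg_lie, lie_neg, neg_neg, cartanForm] at h1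
  rw [sk ξ (sharp Λ ζ) (sharp Λ η), sk ζ (sharp Λ η) (sharp Λ ξ), sk η (sharp Λ ζ) (sharp Λ ξ)] at h1
  have h2 : (2 : 𝕜) ≠ 0 := two_ne_zero
  apply mul_left_cancel₀ h2
  linear_combination h1

theorem IsQuasitriangular.invariant_sharp {s Λ : L ⊗[𝕜] L}
    (h : IsQuasitriangular s Λ) (x : L) (ξ η : Module.Dual 𝕜 L) :
    ξ ⁅x, sharp s η⁆ + η ⁅x, sharp s ξ⁆ = 0 := by
  have := apply_sharp_lie x s ξ η
  rw [h.invariant, h.symm] at this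
  simpa using this.symm

end YangBaxter

/-! ### Block form of the polyuble. -/

section Polyuble

variable {𝕜 L : Type*} [Field 𝕜] [AddCommGroup L] [Module 𝕜 L]

/-- The sign of `s` in the component of `r^{(ε, J)}` in `(L)_j ⊗ (L)_k`. -/
def polyubleSign {J : Type*} [LinearOrder J] (ε : J → ℤˣ) (j k : J) : ℤˣ :=
  if j < k then -1 else if k < j then 1 else ε j

/-- For distinct indices this is transitivity of the order. If `i = j` or `j = k`, the third sign is
one of the two given ones; if only `i = k`, the two given signs are opposite. -/
theorem polyubleSign_trans {J : Type*} [LinearOrder J] (ε : J → ℤˣ) {i j k : J}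
    (h : polyubleSign ε i j = polyubleSign ε j k) : polyubleSign ε i k = polyubleSign ε i j := by
  have hne : (-1 : ℤˣ) ≠ 1 := by decide
  unfold polyubleSign at *
  grind

/-- Subtracting the mixed terms leaves `-(s - Λ)` above the diagonal, because the flip of `s + Λ` is
`s - Λ`, and `s + Λ` below it. -/
theorem polyuble_eq_sum {J : Type*} [Fintype J] [LinearOrder J] (ε : J → ℤˣ) {s Λ : L ⊗[𝕜] L}
    (hs : TensorProduct.comm 𝕜 L L s = s) (hΛ : TensorProduct.comm 𝕜 L L Λ = -Λ) :
    polyuble J ε s Λ = ∑ j : J, ∑ k : J,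
      TensorProduct.map (LinearMap.single 𝕜 (fun _ => L) j) (LinearMap.single 𝕜 (fun _ => L) k)
        (Λ + (((polyubleSign ε j k : ℤˣ) : ℤ) : 𝕜) • s) := by
  let S : J → J → L ⊗[𝕜] L → (J → L) ⊗[𝕜] (J → L) := fun j k =>
    TensorProduct.map (LinearMap.single 𝕜 (fun _ => L) j) (LinearMap.single 𝕜 (fun _ => L) k)
  have h1 : ∀ j k, S j k (Λ + (((polyubleSign ε j k : ℤˣ) : ℤ) : 𝕜) • s) =
      (if j = k then S j j (((ε j : ℤ) : 𝕜) • s + Λ) else 0) -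
        (if j < k then S j k (s - Λ) else 0) + (if k < j then S j k (s + Λ) else 0) := by
    intro j k
    rcases lt_trichotomy j k with h | rfl | h
    · simp [polyubleSign, h, h.ne, h.not_gt, S, map_sub, map_neg]; abel
    · simp [polyubleSign, S, add_comm]
    · simp [polyubleSign, h, h.ne', h.not_gt, S, add_comm]
  have h2 : mix J (s + Λ) = ∑ j : J, ∑ k : J, (if j < k then S j k (s - Λ) else 0) -
      ∑ j : J, ∑ k : J, (if k < j then S j k (s + Λ) else 0) := by
    rw [Finset.sum_comm (f := fun j k => if k < j then S j k (s + Λ) else 0),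
      ← Finset.sum_sub_distrib]
    simp_rw [← Finset.sum_sub_distrib, mix, Finset.sum_filter]
    refine Finset.sum_congr rfl fun j _ => Finset.sum_congr rfl fun k _ => ?_
    split_ifs
    · simp [mixAt, S, hs, hΛ, sub_eq_add_neg]
    · simp
  change _ = ∑ j, ∑ k, S j k _
  simp_rw [h1, Finset.sum_add_distrib, Finset.sum_sub_distrib]
  rw [polyuble, h2]
  simp [at₂, S]
  abel

end Polyuble

/-! ### Contractions and the Yang–Baxter equation for the polyuble. -/

section Contraction

variable {𝕜 A B : Type*} [Field 𝕜] [AddCommGroup A] [Module 𝕜 A] [AddCommGroup B] [Module 𝕜 B]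

/-- `ξ ↦ ∑ ξ(x) y` for `t = ∑ x ⊗ y`. -/
def contractLeft (t : A ⊗[𝕜] A) (ξ : Module.Dual 𝕜 A) : A :=
  TensorProduct.lid 𝕜 A (LinearMap.rTensor A ξ t)

/-- `η ↦ ∑ η(y) x` for `t = ∑ x ⊗ y`. -/
def contractRight (t : A ⊗[𝕜] A) (η : Module.Dual 𝕜 A) : A :=
  TensorProduct.rid 𝕜 A (LinearMap.lTensor A η t)

@[simp]
theorem contractLeft_tmul (a b : A) (ξ : Module.Dual 𝕜 A) :
    contractLeft (a ⊗ₜ[𝕜] b) ξ = ξ a • b := by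
  simp [contractLeft]

@[simp]
theorem contractRight_tmul (a b : A) (ξ : Module.Dual 𝕜 A) :
    contractRight (a ⊗ₜ[𝕜] b) ξ = ξ b • a := by
  simp [contractRight]

theorem contractLeft_sum {ι : Type*} (S : Finset ι) (t : ι → A ⊗[𝕜] A) (ξ : Module.Dual 𝕜 A) :
    contractLeft (∑ i ∈ S, t i) ξ = ∑ i ∈ S, contractLeft (t i) ξ := by
  simp [contractLeft]

theorem contractRight_sum {ι : Type*} (S : Finset ι) (t : ι → A ⊗[𝕜] A) (ξ : Module.Dual 𝕜 A) :
    contractRight (∑ i ∈ S, t i) ξ = ∑ i ∈ S, contractRight (t i) ξ := by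
  simp [contractRight]

theorem contractLeft_map (f g : A →ₗ[𝕜] B) (t : A ⊗[𝕜] A) (ξ : Module.Dual 𝕜 B) :
    contractLeft (TensorProduct.map f g t) ξ = g (contractLeft t (ξ ∘ₗ f)) := by
  induction t with
  | zero => simp [contractLeft]
  | tmul a b => simp
  | add s t hs ht => simp_all [contractLeft]

theorem contractRight_map (f g : A →ₗ[𝕜] B) (t : A ⊗[𝕜] A) (ξ : Module.Dual 𝕜 B) :
    contractRight (TensorProduct.map f g t) ξ = f (contractRight t (ξ ∘ₗ g)) := by
  induction t with
  | zero => simp [contractRight]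
  | tmul a b => simp
  | add s t hs ht => simp_all [contractRight]

theorem contractRight_eq_comm (t : A ⊗[𝕜] A) (ξ : Module.Dual 𝕜 A) :
    contractRight t ξ = contractLeft (TensorProduct.comm 𝕜 A A t) ξ := by
  induction t with
  | zero => simp [contractLeft, contractRight]
  | tmul a b => simp
  | add s t hs ht => simp_all [contractLeft, contractRight]

end Contraction

section YangBaxterForm

variable {𝕜 L : Type*} [Field 𝕜] [LieRing L] [LieAlgebra 𝕜 L]

theorem contractLeft_eq_sharp (t : L ⊗[𝕜] L) (ξ : Module.Dual 𝕜 L) :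
    contractLeft t ξ = sharp t ξ := rfl

/-- For `r = ∑ x ⊗ y` in `L^J ⊗ L^J`, the value on three linear forms of
`∑ ∑ [x, x'] ⊗ y ⊗ y' + x ⊗ [y, x'] ⊗ y' + x ⊗ x' ⊗ [y, y']`. -/
def yangBaxterForm {J : Type*} (r : (J → L) ⊗[𝕜] (J → L)) (ξ η ζ : Module.Dual 𝕜 (J → L)) : 𝕜 :=
  ξ (fun j => ⁅contractRight r η j, contractRight r ζ j⁆) +
    η (fun j => ⁅contractLeft r ξ j, contractRight r ζ j⁆) +
    ζ (fun j => ⁅contractLeft r ξ j, contractLeft r η j⁆)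

theorem contractLeft_sum_single {J : Type*} [Fintype J] [DecidableEq J] (R : J → J → L ⊗[𝕜] L)
    (θ : Module.Dual 𝕜 (J → L)) (k : J) :
    contractLeft (∑ i : J, ∑ j : J, TensorProduct.map (LinearMap.single 𝕜 (fun _ => L) i)
      (LinearMap.single 𝕜 (fun _ => L) j) (R i j)) θ k =
      ∑ i, sharp (R i k) (θ ∘ₗ LinearMap.single 𝕜 (fun _ => L) i) := by
  simp [contractLeft_sum, contractLeft_map, Finset.sum_apply, Pi.single_apply,
    contractLeft_eq_sharp]

theorem contractRight_sum_single {J : Type*} [Fintype J] [DecidableEq J] (R : J → J → L ⊗[𝕜] L)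
    (θ : Module.Dual 𝕜 (J → L)) (k : J) :
    contractRight (∑ i : J, ∑ j : J, TensorProduct.map (LinearMap.single 𝕜 (fun _ => L) i)
      (LinearMap.single 𝕜 (fun _ => L) j) (R i j)) θ k =
      ∑ j, sharp (TensorProduct.comm 𝕜 L L (R k j)) (θ ∘ₗ LinearMap.single 𝕜 (fun _ => L) j) := by
  rw [Finset.sum_comm]
  simp only [contractRight_sum, contractRight_map, Finset.sum_apply]
  simp [Pi.single_apply, contractRight_eq_comm, contractLeft_eq_sharp]

/-- The bracket of `L^J` is componentwise, so the form is a sum over triples `(i, j, k)` of slots.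
Each summand is `yangBaxter_signs` for the signs of the blocks `(i,j)`, `(i,k)`, `(j,k)`. -/
theorem yangBaxterForm_polyuble [CharZero 𝕜] {J : Type*} [Fintype J] [LinearOrder J]
    (ε : J → ℤˣ) {s Λ : L ⊗[𝕜] L} (h : IsQuasitriangular s Λ) (ξ η ζ : Module.Dual 𝕜 (J → L)) :
    yangBaxterForm (polyuble J ε s Λ) ξ η ζ = 0 := by
  have hx : ∀ (θ : Module.Dual 𝕜 (J → L)) (x : J → L),
      θ x = ∑ j, (θ ∘ₗ LinearMap.single 𝕜 (fun _ => L) j) (x j) := by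
    intro θ x
    conv_lhs => rw [← Finset.univ_sum_single x]
    simp
  have expand : ∀ (θ : J → Module.Dual 𝕜 L) (A B : J → J → L),
      ∑ i, θ i ⁅∑ j, A i j, ∑ k, B i k⁆ = ∑ i, ∑ j, ∑ k, θ i ⁅A i j, B i k⁆ := by
    intro θ A B
    refine Finset.sum_congr rfl fun i _ => ?_
    rw [sum_lie, map_sum]
    refine Finset.sum_congr rfl fun j _ => ?_
    rw [lie_sum, map_sum]
  rw [yangBaxterForm, hx ξ, hx η, hx ζ, polyuble_eq_sum ε h.symm h.skew]
  simp only [contractLeft_sum_single, contractRight_sum_single, expand]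
  simp only [map_add, map_smul, h.symm, h.skew, sharp_add, sharp_smul, sharp_neg]
  -- The sums are reordered so that `i`, `j`, `k` are the slots of `ξ`, `η`, `ζ` in all three terms.
  rw [Finset.sum_comm (γ := J) (f := fun i j => ∑ k, (η ∘ₗ LinearMap.single 𝕜 (fun _ => L) i) _),
    Finset.sum_comm (γ := J) (f := fun i j => ∑ k, (ζ ∘ₗ LinearMap.single 𝕜 (fun _ => L) i) _)]
  simp_rw [Finset.sum_comm (γ := J) (f := fun i j => (ζ ∘ₗ LinearMap.single 𝕜 (fun _ => L) i) _),
    ← Finset.sum_add_distrib]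
  refine Finset.sum_eq_zero fun i _ => Finset.sum_eq_zero fun j _ => Finset.sum_eq_zero fun k _ => ?_
  exact yangBaxter_signs h.invariant_sharp h.yangBaxter_sharp
    (fun e => polyubleSign_trans ε e) _ _ _

end YangBaxterForm

end RMatrix

/-! ### From the Yang–Baxter equation to the Jacobi identity. -/

namespace RMatrix

variable {𝕜 L J M : Type*} [Field 𝕜] [LieRing L] [LieAlgebra 𝕜 L]

/-- The Jacobi identity for the bracket `{f, g} = ∑ X f · Y g`, where `∑ X ⊗ Y` is the image of a
solution of the classical Yang–Baxter equation under an action of `L^J` by derivations.  The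
derivative of `f` along `a` at `p` is `D f p a`, and `P` is a class of functions on
which `D` acts by derivations at the points of `U`. -/
theorem jacobi_of_yangBaxterForm (r : (J → L) ⊗[𝕜] (J → L))
    (D : (M → 𝕜) → M → Module.Dual 𝕜 (J → L)) (P : (M → 𝕜) → Prop) (U : Set M)
    (hD : ∀ f, P f → ∀ a, P fun p => D f p a)
    (hmul : ∀ f g, P f → P g → P fun p => f p * g p)
    (hDsum : ∀ (S : Finset ((J → L) × (J → L))) (F : (J → L) × (J → L) → M → 𝕜),
      (∀ i, P (F i)) → ∀ p ∈ U, D (fun q => ∑ i ∈ S, F i q) p = ∑ i ∈ S, D (F i) p)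
    (hDneg : ∀ f, ∀ p ∈ U, D (fun q => -f q) p = -D f p)
    (hDmul : ∀ f g, P f → P g → ∀ p ∈ U,
      D (fun q => f q * g q) p = f p • D g p + g p • D f p)
    (hlie : ∀ f, P f → ∀ p ∈ U, ∀ a b,
      D (fun q => D f q a) p b - D (fun q => D f q b) p a = D f p (fun j => ⁅b j, a j⁆))
    (B : (M → 𝕜) → (M → 𝕜) → M → 𝕜)
    (hB : ∀ f g p, B f g p = LinearMap.mul' 𝕜 𝕜 (TensorProduct.map (D f p) (D g p) r))
    (hskew : ∀ f g p, B f g p = -B g f p)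
    (hyb : ∀ ξ η ζ, yangBaxterForm r ξ η ζ = 0)
    {f g h : M → 𝕜} (hf : P f) (hg : P g) (hh : P h) {p : M} (hp : p ∈ U) :
    B f (B g h) p + B g (B h f) p + B h (B f g) p = 0 := by
  obtain ⟨S, hS⟩ := TensorProduct.exists_finset r
  have hB' : ∀ f g p, B f g p = ∑ i ∈ S, D f p i.1 * D g p i.2 := by
    intro f g p
    rw [hB, hS]
    simp
  have hBD : ∀ f g, P f → P g → ∀ a, D (B f g) p a =
      ∑ j ∈ S, (D f p j.1 * D (fun q => D g q j.2) p a + D g p j.2 * D (fun q => D f q j.1) p a) := by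
    intro f g hf hg a
    have h1 : B f g = fun q => ∑ i ∈ S, D f q i.1 * D g q i.2 := funext (hB' f g)
    rw [h1, hDsum S (fun i q => D f q i.1 * D g q i.2)
      (fun i => hmul _ _ (hD _ hf _) (hD _ hg _)) p hp, LinearMap.sum_apply]
    refine Finset.sum_congr rfl fun j _ => ?_
    rw [hDmul _ _ (hD _ hf _) (hD _ hg _) p hp]
    simp
  -- With `e3`, the Jacobiator becomes `{f,{g,h}} - {g,{f,h}} - {{f,g},h}`. Then the second
  -- derivatives of `g` and `h` already occur as commutators.
  have e2 : B g (B h f) p = -B g (B f h) p := by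
    have : B h f = fun q => -B f h q := funext (hskew h f)
    rw [this, hB', hB', ← Finset.sum_neg_distrib]
    simp [hDneg _ p hp]
  have e3 : B h (B f g) p = -B (B f g) h p := hskew _ _ _
  -- The second derivatives of `f` become a commutator only after skewness of the bracket is applied
  -- to `g` and the derivative of `f` along the first leg `j.1`.
  have e4 : ∑ i ∈ S, ∑ j ∈ S, D g p i.1 * D (fun q => D f q j.1) p i.2 * D h p j.2 =
      -∑ i ∈ S, ∑ j ∈ S, D (fun q => D f q j.1) p i.1 * D g p i.2 * D h p j.2 := by
    rw [Finset.sum_comm (f := fun (i j : (J → L) × (J → L)) =>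
      D g p i.1 * D (fun q => D f q j.1) p i.2 * D h p j.2), Finset.sum_comm (f := fun (i j : (J → L) × (J → L)) =>
      D (fun q => D f q j.1) p i.1 * D g p i.2 * D h p j.2), ← Finset.sum_neg_distrib]
    refine Finset.sum_congr rfl fun j _ => ?_
    have := hskew g (fun q => D f q j.1) p
    rw [hB', hB'] at this
    rw [← Finset.sum_mul, ← Finset.sum_mul, this, neg_mul]
  have hl : ∀ θ, contractLeft r θ = ∑ i ∈ S, θ i.1 • i.2 := by
    intro θ; rw [hS, contractLeft_sum]; simp
  have hr : ∀ θ, contractRight r θ = ∑ i ∈ S, θ i.2 • i.1 := by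
    intro θ; rw [hS, contractRight_sum]; simp
  have hbr : ∀ (θ : Module.Dual 𝕜 (J → L)) (c d : (J → L) × (J → L) → 𝕜)
      (x y : (J → L) × (J → L) → J → L),
      θ (fun k => ⁅(∑ i ∈ S, c i • x i) k, (∑ i ∈ S, d i • y i) k⁆) =
        ∑ i ∈ S, ∑ j ∈ S, c i * d j * θ (fun k => ⁅x i k, y j k⁆) := by
    intro θ c d x y
    have : (fun k => ⁅(∑ i ∈ S, c i • x i) k, (∑ i ∈ S, d i • y i) k⁆) =
        ∑ i ∈ S, ∑ j ∈ S, (c i * d j) • (fun k => ⁅x i k, y j k⁆) := by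
      funext k
      simp only [Finset.sum_apply, sum_lie, Pi.smul_apply, lie_sum, smul_lie, lie_smul, mul_smul,
        Finset.smul_sum]
      rw [Finset.sum_comm]
      exact Finset.sum_congr rfl fun i _ => Finset.sum_congr rfl fun j _ => smul_comm _ _ _
    rw [this]
    simp
  -- Read through `hlie`, the three terms of the Yang–Baxter form are exactly the three groups of
  -- commutators.
  have hyb' := hyb (D f p) (D g p) (D h p)
  simp only [yangBaxterForm, hl, hr, hbr, ← hlie f hf p hp, ← hlie g hg p hp, ← hlie h hh p hp]
    at hyb'
  rw [e2, e3, hB' f, hB' g, hB' _ h]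
  simp only [hBD f g hf hg, hBD f h hf hh, hBD g h hg hh, Finset.mul_sum, Finset.sum_mul]
  have s1 : ∑ i ∈ S, ∑ j ∈ S, D g p i.1 * (D f p j.1 * D (fun q => D h q j.2) p i.2) =
      ∑ i ∈ S, ∑ j ∈ S, D g p j.1 * (D f p i.1 * D (fun q => D h q i.2) p j.2) := Finset.sum_comm
  have s2 : ∑ i ∈ S, ∑ j ∈ S, (D f p j.1 * D (fun q => D g q j.2) p i.1 +
      D g p j.2 * D (fun q => D f q j.1) p i.1) * D h p i.2 =
      ∑ i ∈ S, ∑ j ∈ S, (D f p i.1 * D (fun q => D g q i.2) p j.1 +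
      D g p i.2 * D (fun q => D f q i.1) p j.1) * D h p j.2 := Finset.sum_comm
  have s3 : ∑ i ∈ S, ∑ j ∈ S, D g p i.1 * (D f p j.1 * D (fun q => D h q j.2) p i.2 +
      D h p j.2 * D (fun q => D f q j.1) p i.2) =
      ∑ i ∈ S, ∑ j ∈ S, D g p i.1 * (D f p j.1 * D (fun q => D h q j.2) p i.2) +
      ∑ i ∈ S, ∑ j ∈ S, D g p i.1 * D (fun q => D f q j.1) p i.2 * D h p j.2 := by
    simp only [← Finset.sum_add_distrib]
    refine Finset.sum_congr rfl fun i _ => Finset.sum_congr rfl fun j _ => ?_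
    ring
  rw [s3, s1, s2, e4, ← hyb']
  simp only [← Finset.sum_add_distrib, ← Finset.sum_neg_distrib]
  refine Finset.sum_congr rfl fun i _ => Finset.sum_congr rfl fun j _ => ?_
  ring

end RMatrix

/-! ### From one vertex to the whole graph. -/

namespace OrientedCiliatedGraph

open RMatrix

variable {V Edge : Type*} (Γ : OrientedCiliatedGraph V Edge)
variable [Fintype V] [DecidableEq V] [Fintype Edge] [DecidableEq Edge]

section Module

variable {𝕜 L : Type*} [Field 𝕜] [AddCommGroup L] [Module 𝕜 L]

theorem inclusion_apply (v : V) (x : Γ.Star v → L) (α : HalfEdge Edge) :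
    Γ.inclusion (𝕜 := 𝕜) v x α =
      if h : Sum.elim Γ.source Γ.target α = v then x ⟨α, h⟩ else 0 := by
  simp only [inclusion, LinearMap.sum_apply, LinearMap.comp_apply, LinearMap.proj_apply,
    LinearMap.single_apply, Finset.sum_apply, Pi.single_apply]
  split_ifs with h
  · rw [Finset.sum_eq_single ⟨α, h⟩]
    · simp
    · intro β _ hβ
      rw [if_neg]
      rintro rfl
      exact hβ rfl
    · simp
  · refine Finset.sum_eq_zero fun β _ => if_neg ?_
    rintro rfl
    exact h β.2

theorem inclusion_comp_single (v : V) {_ : DecidableEq (Γ.Star v)} (α : Γ.Star v) :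
    Γ.inclusion v ∘ₗ LinearMap.single 𝕜 (fun _ => L) α =
      LinearMap.single 𝕜 (fun _ : HalfEdge Edge => L) α.1 := by
  ext x β
  simp only [LinearMap.comp_apply, inclusion_apply, LinearMap.single_apply, Pi.single_apply,
    Subtype.ext_iff]
  by_cases hβ : β = α.1
  · simp [hβ, α.2]
  · simp [hβ]

theorem map_inclusion_at₂ (v : V) {_ : DecidableEq (Γ.Star v)} (α : Γ.Star v) (s : L ⊗[𝕜] L) :
    TensorProduct.map (Γ.inclusion v) (Γ.inclusion v) (at₂ α s) = at₂ α.1 s := by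
  simp only [at₂]
  rw [← LinearMap.comp_apply, ← TensorProduct.map_comp, inclusion_comp_single]

/-- The mixed terms and `Λ` are skew, so only the diagonal copies of `s` survive symmetrisation. -/
theorem polyuble_add_comm {J : Type*} [Fintype J] [LinearOrder J] (ε : J → ℤˣ) {s Λ : L ⊗[𝕜] L}
    (hs : TensorProduct.comm 𝕜 L L s = s) (hΛ : TensorProduct.comm 𝕜 L L Λ = -Λ) :
    polyuble J ε s Λ + TensorProduct.comm 𝕜 _ _ (polyuble J ε s Λ) =
      (2 : 𝕜) • ∑ j : J, ((ε j : ℤ) : 𝕜) • at₂ j s := by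
  have hmix : TensorProduct.comm 𝕜 _ _ (mix J (s + Λ)) = -mix J (s + Λ) := by
    simp [mix, mixAt, ← TensorProduct.map_comm, hs, hΛ]
  have hat : ∀ (j : J) (t : L ⊗[𝕜] L), TensorProduct.comm 𝕜 _ _ (at₂ j t) =
      at₂ j (TensorProduct.comm 𝕜 L L t) := by
    intro j t
    simp [at₂, ← TensorProduct.map_comm]
  have hadd : ∀ j : J, at₂ j (((ε j : ℤ) : 𝕜) • s + Λ) = ((ε j : ℤ) : 𝕜) • at₂ j s + at₂ j Λ := by
    simp [at₂]
  have hneg : ∀ j : J, at₂ j (-Λ) = -at₂ j Λ := by simp [at₂]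
  simp only [polyuble, map_sub, map_sum, hmix, hadd, map_add, map_smul, hat, hs, hΛ, hneg,
    Finset.sum_add_distrib, Finset.sum_neg_distrib, two_smul]
  abel

/-- The stars of the vertices partition the half edges, so the signed copies of `s` can be regrouped
edge by edge. -/
theorem rMatrix_add_comm {s : L ⊗[𝕜] L} {Λ : V → L ⊗[𝕜] L}
    (hs : TensorProduct.comm 𝕜 L L s = s) (hΛ : ∀ v, TensorProduct.comm 𝕜 L L (Λ v) = -Λ v) :
    Γ.rMatrix s Λ + TensorProduct.comm 𝕜 _ _ (Γ.rMatrix s Λ) =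
      (2 : 𝕜) • ∑ γ : Edge, (at₂ (Sum.inl γ : HalfEdge Edge) s - at₂ (Sum.inr γ) s) := by
  have h : ∀ v, letI := Γ.order v
      TensorProduct.map (Γ.inclusion v) (Γ.inclusion v)
        (polyuble (Γ.Star v) (Γ.sign v) s (Λ v)) +
      TensorProduct.comm 𝕜 _ _ (TensorProduct.map (Γ.inclusion v) (Γ.inclusion v)
        (polyuble (Γ.Star v) (Γ.sign v) s (Λ v))) =
      (2 : 𝕜) • ∑ α : Γ.Star v, ((Γ.sign v α : ℤ) : 𝕜) • at₂ α.1 s := by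
    intro v
    letI := Γ.order v
    have hc : ∀ t : (Γ.Star v → L) ⊗[𝕜] (Γ.Star v → L), TensorProduct.comm 𝕜 _ _
        (TensorProduct.map (Γ.inclusion (𝕜 := 𝕜) (L := L) v) (Γ.inclusion (𝕜 := 𝕜) v) t) =
        TensorProduct.map (Γ.inclusion v) (Γ.inclusion v) (TensorProduct.comm 𝕜 _ _ t) := by
      intro t
      simp [← TensorProduct.map_comm]
    rw [hc, ← map_add, polyuble_add_comm _ hs (hΛ v), map_smul, map_sum]
    congr 1
    exact Finset.sum_congr rfl fun α _ => by rw [map_smul, map_inclusion_at₂]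
  rw [rMatrix, map_sum, ← Finset.sum_add_distrib, Finset.sum_congr rfl fun v _ => h v,
    ← Finset.smul_sum]
  congr 1
  have h2 : ∀ v, ∑ α : Γ.Star v, ((Γ.sign v α : ℤ) : 𝕜) • at₂ α.1 s =
      ∑ α : HalfEdge Edge with Sum.elim Γ.source Γ.target α = v,
        (((Sum.elim (fun _ => 1) (fun _ => -1) α : ℤˣ) : ℤ) : 𝕜) • at₂ α s := by
    intro v
    exact (Finset.sum_subtype_eq_sum_filter (s := Finset.univ)
      (f := fun α : HalfEdge Edge =>
        (((Sum.elim (fun _ => 1) (fun _ => -1) α : ℤˣ) : ℤ) : 𝕜) • at₂ α s)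
      (p := fun α => Sum.elim Γ.source Γ.target α = v)) ▸ by simp [sign]
  rw [Finset.sum_congr rfl fun v _ => h2 v, Finset.sum_fiberwise, Fintype.sum_sum_type,
    ← Finset.sum_add_distrib]
  refine Finset.sum_congr rfl fun γ _ => ?_
  simp only [Sum.elim_inl, Sum.elim_inr, Units.val_one, Units.val_neg, Int.cast_one, Int.cast_neg,
    one_smul, sub_eq_add_neg]
  exact congrArg _ (neg_one_smul 𝕜 (at₂ (Sum.inr γ : HalfEdge Edge) s))

end Module

/-- Different stars are disjoint, so brackets between them vanish and the form is the sum of the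
forms at the vertices. -/
theorem yangBaxterForm_rMatrix {𝕜 L : Type*} [Field 𝕜] [CharZero 𝕜] [LieRing L] [LieAlgebra 𝕜 L]
    {s : L ⊗[𝕜] L} {Λ : V → L ⊗[𝕜] L} (h : ∀ v, IsQuasitriangular s (Λ v))
    (ξ η ζ : Module.Dual 𝕜 (HalfEdge Edge → L)) :
    yangBaxterForm (Γ.rMatrix s Λ) ξ η ζ = 0 := by
  have hbr : ∀ (θ : Module.Dual 𝕜 (HalfEdge Edge → L)) (x y : ∀ v, Γ.Star v → L),
      θ (fun α => ⁅(∑ v, Γ.inclusion (𝕜 := 𝕜) v (x v)) α, (∑ v, Γ.inclusion (𝕜 := 𝕜) v (y v)) α⁆) =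
        ∑ v, (θ ∘ₗ Γ.inclusion v) (fun α => ⁅x v α, y v α⁆) := by
    intro θ x y
    have : (fun α => ⁅(∑ v, Γ.inclusion (𝕜 := 𝕜) v (x v)) α,
        (∑ v, Γ.inclusion (𝕜 := 𝕜) v (y v)) α⁆) =
        ∑ v, Γ.inclusion (𝕜 := 𝕜) v (fun α => ⁅x v α, y v α⁆) := by
      funext α
      simp [Finset.sum_apply, inclusion_apply]
    rw [this]
    simp
  have h1 := fun v =>
    letI := Γ.order v
    yangBaxterForm_polyuble (Γ.sign v) (h v) (ξ ∘ₗ Γ.inclusion v) (η ∘ₗ Γ.inclusion v)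
      (ζ ∘ₗ Γ.inclusion v)
  simp only [yangBaxterForm, rMatrix, contractLeft_sum, contractLeft_map, contractRight_sum,
    contractRight_map, hbr, ← Finset.sum_add_distrib]
  exact Finset.sum_eq_zero fun v _ => h1 v

end OrientedCiliatedGraph

/-! ### Charts and holomorphic maps for the product manifold. -/

section PowManifold

variable {E : Type*} [NormedAddCommGroup E] [NormedSpace ℂ E] {J : Type*} [Fintype J]
  {G : Type*} [TopologicalSpace G] [ChartedSpace E G]
  {F : Type*} [NormedAddCommGroup F] [NormedSpace ℂ F] {H : Type*} [TopologicalSpace H]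
  {I : ModelWithCorners ℂ F H} {N : Type*} [TopologicalSpace N] [ChartedSpace H N]

theorem range_powModel : Set.range (powModel E J) = Set.univ := by
  refine Set.eq_univ_of_forall fun u => ⟨u, rfl⟩

theorem contMDiffAt_powModel {n : ℕ∞ω} {f : N → J → G} {x : N}
    (h : ∀ j, ContMDiffAt I 𝓘(ℂ, E) n (fun y => f y j) x) :
    ContMDiffAt I (powModel E J) n f x := by
  rw [contMDiffAt_iff]
  refine ⟨continuousAt_pi.2 fun j => (h j).continuousAt, ?_⟩
  exact contDiffWithinAt_pi.2 fun j => (contMDiffAt_iff.1 (h j)).2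

theorem contMDiff_proj {n : ℕ∞ω} (j : J) :
    ContMDiff (powModel E J) 𝓘(ℂ, E) n (fun g : J → G => g j) := by
  intro g
  rw [contMDiffAt_iff]
  refine ⟨(continuous_apply j).continuousAt, ?_⟩
  have h : ContDiffWithinAt ℂ n (fun u : J → E => u j) (Set.range (powModel E J))
      (extChartAt (powModel E J) g g) := (contDiff_apply ℂ E j).contDiffWithinAt
  refine h.congr_of_eventuallyEq ?_ ?_
  · have h1 : (extChartAt 𝓘(ℂ, E) (g j)).target ∈ nhds (extChartAt 𝓘(ℂ, E) (g j) (g j)) :=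
      extChartAt_target_mem_nhds (g j)
    have h2 := (continuous_apply j).continuousAt.preimage_mem_nhds
      (x := extChartAt (powModel E J) g g) h1
    filter_upwards [nhdsWithin_le_nhds h2] with u hu
    exact (extChartAt 𝓘(ℂ, E) (g j)).right_inv hu
  · exact (extChartAt 𝓘(ℂ, E) (g j)).right_inv (mem_extChartAt_target (g j))

theorem contMDiffAt_extChartAt_powModel [IsManifold 𝓘(ℂ, E) ω G] (g : J → G) :
    ContMDiffAt (powModel E J) 𝓘(ℂ, J → E) ω (extChartAt (powModel E J) g) g := by
  rw [contMDiffAt_pi_space]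
  intro j
  exact (contMDiffAt_extChartAt (I := 𝓘(ℂ, E)) (x := g j)).comp g (contMDiff_proj j).contMDiffAt

theorem extChartAt_powModel_source_mem_nhds (g : J → G) :
    ∀ᶠ h in nhds g, (extChartAt (powModel E J) g).symm (extChartAt (powModel E J) g h) = h :=
  Filter.eventually_of_mem (extChartAt_source_mem_nhds g)
    fun _ hh => (extChartAt (powModel E J) g).left_inv hh

end PowManifold

section ChartHelpers

variable {E : Type*} [NormedAddCommGroup E] [NormedSpace ℂ E]
  {G : Type*} [TopologicalSpace G] [ChartedSpace E G] [IsManifold 𝓘(ℂ, E) ω G]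
  {X : Type*} [NormedAddCommGroup X] [NormedSpace ℂ X]

theorem ContMDiffAt.contDiffAt_extChartAt {F : X → G} {x : X}
    (hF : ContMDiffAt 𝓘(ℂ, X) 𝓘(ℂ, E) ω F x) {g : G} (hg : F x = g) :
    ContDiffAt ℂ ω (fun y => extChartAt 𝓘(ℂ, E) g (F y)) x := by
  subst hg
  exact (contMDiffAt_extChartAt.comp x hF).contDiffAt

theorem ContDiffAt.contMDiffAt_extChartAt_symm {f : X → E} {x : X} (hf : ContDiffAt ℂ ω f x)
    {g : G} (hg : f x ∈ (extChartAt 𝓘(ℂ, E) g).target) :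
    ContMDiffAt 𝓘(ℂ, X) 𝓘(ℂ, E) ω (fun y => (extChartAt 𝓘(ℂ, E) g).symm (f y)) x := by
  have h : ContMDiffAt 𝓘(ℂ, E) 𝓘(ℂ, E) ω (extChartAt 𝓘(ℂ, E) g).symm (f x) :=
    (contMDiffOn_extChartAt_symm g).contMDiffAt
      ((isOpen_extChartAt_target g).mem_nhds hg)
  exact h.comp x hf.contMDiffAt

end ChartHelpers

/-! ### The group law and the Lie bracket in the chart at the identity. -/

namespace UnitChart

section

variable (E : Type*) [NormedAddCommGroup E] [NormedSpace ℂ E]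
  (G : Type*) [TopologicalSpace G] [ChartedSpace E G] [Group G]

/-- The preferred chart of `G` at the identity. -/
noncomputable abbrev chart : PartialEquiv G E := extChartAt 𝓘(ℂ, E) (1 : G)

/-- The coordinates of the identity. -/
noncomputable abbrev origin : E := chart E G 1

/-- The multiplication of `G` in the chart at the identity. -/
noncomputable def mul (p : E × E) : E := chart E G ((chart E G).symm p.1 * (chart E G).symm p.2)

/-- The derivative at the identity of the left translation by the point with coordinates `u`,
read in the chart at the identity. -/
noncomputable def leftDeriv (u : E) : E →L[ℂ] E := fderiv ℂ (fun v => mul E G (u, v)) (origin E G)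

end

variable {E : Type*} [NormedAddCommGroup E] [NormedSpace ℂ E]
  {G : Type*} [TopologicalSpace G] [ChartedSpace E G] [Group G]

theorem symm_origin : (chart E G).symm (origin E G) = 1 :=
  (chart E G).left_inv (mem_extChartAt_source 1)

theorem origin_mem_target : origin E G ∈ (chart E G).target := mem_extChartAt_target 1

theorem eventually_mem_target : ∀ᶠ u in nhds (origin E G), u ∈ (chart E G).target :=
  extChartAt_target_mem_nhds 1

theorem mul_origin_left {v : E} (hv : v ∈ (chart E G).target) : mul E G (origin E G, v) = v := by
  simp only [mul, symm_origin, one_mul]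
  exact (chart E G).right_inv hv

theorem mul_origin_right {v : E} (hv : v ∈ (chart E G).target) : mul E G (v, origin E G) = v := by
  simp only [mul, symm_origin, mul_one]
  exact (chart E G).right_inv hv

variable [LieGroup 𝓘(ℂ, E) ω G]

theorem contMDiffAt_symm {u : E} (hu : u ∈ (chart E G).target) :
    ContMDiffAt 𝓘(ℂ, E) 𝓘(ℂ, E) ω (chart E G).symm u :=
  ContDiffAt.contMDiffAt_extChartAt_symm (f := fun u : E => u) contDiffAt_id hu

theorem contMDiffAt_symm_mul_symm {u v : E} (hu : u ∈ (chart E G).target)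
    (hv : v ∈ (chart E G).target) :
    ContMDiffAt 𝓘(ℂ, E × E) 𝓘(ℂ, E) ω
      (fun p : E × E => (chart E G).symm p.1 * (chart E G).symm p.2) (u, v) :=
  (ContDiffAt.contMDiffAt_extChartAt_symm contDiffAt_fst hu).mul
    (ContDiffAt.contMDiffAt_extChartAt_symm contDiffAt_snd hv)

theorem contDiffAt_mul : ContDiffAt ℂ ω (mul E G) (origin E G, origin E G) :=
  (contMDiffAt_symm_mul_symm origin_mem_target origin_mem_target).contDiffAt_extChartAt
    (by simp only [symm_origin, mul_one])

/-- Near the identity, products of points of the chart domain are in the chart domain. -/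
theorem eventually_symm_mul :
    ∀ᶠ p in nhds (origin E G, origin E G),
      (chart E G).symm (mul E G p) = (chart E G).symm p.1 * (chart E G).symm p.2 := by
  have h1 := (contMDiffAt_symm_mul_symm (E := E) (G := G) origin_mem_target origin_mem_target).continuousAt
  have h2 : (chart E G).source ∈ nhds ((chart E G).symm (origin E G) * (chart E G).symm (origin E G)) := by
    rw [symm_origin, mul_one]
    exact extChartAt_source_mem_nhds 1
  filter_upwards [h1.preimage_mem_nhds h2] with p hp
  exact (chart E G).left_inv hp

theorem eventually_contDiffAt_mul :
    ∀ᶠ p in nhds (origin E G, origin E G), ContDiffAt ℂ ω (mul E G) p :=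
  contDiffAt_mul.eventually (by simp)

theorem eventually_contDiffAt_mul_left :
    ∀ᶠ u in nhds (origin E G), ContDiffAt ℂ ω (mul E G) (u, origin E G) :=
  ((continuous_id.prodMk continuous_const).continuousAt (x := origin E G)).eventually
    eventually_contDiffAt_mul

theorem leftDeriv_eq {u : E} (hu : ContDiffAt ℂ ω (mul E G) (u, origin E G)) :
    leftDeriv E G u = fderiv ℂ (mul E G) (u, origin E G) ∘L ContinuousLinearMap.inr ℂ E E := by
  have h1 : HasFDerivAt (mul E G) (fderiv ℂ (mul E G) (u, origin E G)) (u, origin E G) :=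
    (hu.differentiableAt (by simp)).hasFDerivAt
  exact (h1.comp (origin E G) (hasFDerivAt_prodMk_right u (origin E G))).fderiv

theorem contDiffAt_leftDeriv : ContDiffAt ℂ ω (leftDeriv E G) (origin E G) := by
  have h1 : ContDiffAt ℂ ω (fderiv ℂ (mul E G)) (origin E G, origin E G) :=
    contDiffAt_mul.fderiv_right (by simp)
  have h2 : ContDiffAt ℂ ω (fun u => fderiv ℂ (mul E G) (u, origin E G)) (origin E G) :=
    h1.comp (f := fun u => (u, origin E G)) (origin E G) (contDiffAt_id.prodMk contDiffAt_const)
  refine (h2.clm_comp (contDiffAt_const (c := ContinuousLinearMap.inr ℂ E E))).congr_of_eventuallyEq ?_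
  exact eventually_contDiffAt_mul_left.mono fun u hu => leftDeriv_eq hu

theorem leftDeriv_origin : leftDeriv E G (origin E G) = ContinuousLinearMap.id ℂ E := by
  have h : (fun v => mul E G (origin E G, v)) =ᶠ[nhds (origin E G)] id :=
    eventually_mem_target.mono fun v hv => mul_origin_left hv
  rw [leftDeriv, h.fderiv_eq, fderiv_id]

theorem mulInvariantVectorField_eq (a : LieAlg E G) (g : G) :
    mulInvariantVectorField a g =
      fderiv ℂ (fun v => extChartAt 𝓘(ℂ, E) g (g * (chart E G).symm v)) (origin E G) a := by
  have h : MDifferentiableAt 𝓘(ℂ, E) 𝓘(ℂ, E) (g * ·) (1 : G) :=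
    (contMDiff_mul_left (I := 𝓘(ℂ, E)) (n := ω) (a := g)).mdifferentiableAt (by simp)
  rw [mulInvariantVectorField, h.mfderiv]
  simp only [writtenInExtChartAt, mul_one, modelWithCornersSelf_coe, Set.range_id, fderivWithin_univ]
  rfl

theorem mfderiv_symm {u : E} (hu : u ∈ (chart E G).target) :
    mfderiv 𝓘(ℂ, E) 𝓘(ℂ, E) (chart E G).symm u =
      fderiv ℂ (fun v => extChartAt 𝓘(ℂ, E) ((chart E G).symm u) ((chart E G).symm v)) u := by
  rw [((contMDiffAt_symm hu).mdifferentiableAt (by simp)).mfderiv]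
  simp only [writtenInExtChartAt, modelWithCornersSelf_coe, Set.range_id, fderivWithin_univ]
  rfl

/-- The left-invariant field at a point is read in the chart at that point. Translation in that
chart is the transition map composed with `mul E G (u, ·)`, and pulling back removes the derivative
of the transition map. -/
theorem mpullback_mulInvariantVectorField_eq (a : LieAlg E G) :
    VectorField.mpullbackWithin 𝓘(ℂ, E) 𝓘(ℂ, E) (chart E G).symm (mulInvariantVectorField a)
      (Set.range 𝓘(ℂ, E)) =ᶠ[nhds (origin E G)] fun u => leftDeriv E G u a := by
  have h0 := eventually_symm_mul (E := E) (G := G)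
  have h1 := h0.curry_nhds
  filter_upwards [eventually_mem_target, eventually_contDiffAt_mul_left, h1] with u hu hd hs
  rw [VectorField.mpullbackWithin_apply]
  have hinv := isInvertible_mfderivWithin_extChartAt_symm (I := 𝓘(ℂ, E)) (x := (1 : G)) hu
  have hd1 : DifferentiableAt ℂ
      (fun v => extChartAt 𝓘(ℂ, E) ((chart E G).symm u) ((chart E G).symm v)) u :=
    ((contMDiffAt_symm hu).contDiffAt_extChartAt rfl).differentiableAt (by simp)
  have hd2 : HasFDerivAt (fun v => mul E G (u, v)) (leftDeriv E G u) (origin E G) := by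
    refine DifferentiableAt.hasFDerivAt ?_
    exact (hd.differentiableAt (by simp)).comp (f := fun v => (u, v)) (origin E G)
      (hasFDerivAt_prodMk_right u (origin E G)).differentiableAt
  have key : fderiv ℂ (fun v => extChartAt 𝓘(ℂ, E) ((chart E G).symm u)
        ((chart E G).symm u * (chart E G).symm v)) (origin E G) =
      fderiv ℂ (fun v => extChartAt 𝓘(ℂ, E) ((chart E G).symm u) ((chart E G).symm v)) u ∘L
        leftDeriv E G u := by
    have hd1' : HasFDerivAt
        (fun v => extChartAt 𝓘(ℂ, E) ((chart E G).symm u) ((chart E G).symm v))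
        (fderiv ℂ (fun v => extChartAt 𝓘(ℂ, E) ((chart E G).symm u) ((chart E G).symm v)) u)
        (mul E G (u, origin E G)) := by
      rw [mul_origin_right hu]
      exact hd1.hasFDerivAt
    refine ((hd1'.comp (origin E G) hd2).congr_of_eventuallyEq ?_).fderiv
    exact hs.mono fun v hv => congrArg _ hv.symm
  refine hinv.inverse_apply_eq.2 ?_
  refine (mulInvariantVectorField_eq a _).trans ((DFunLike.congr_fun key a).trans ?_)
  have e1 : mfderivWithin 𝓘(ℂ, E) 𝓘(ℂ, E) (chart E G).symm (Set.range 𝓘(ℂ, E)) u =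
      mfderiv 𝓘(ℂ, E) 𝓘(ℂ, E) (chart E G).symm u := by
    rw [modelWithCornersSelf_coe, Set.range_id, mfderivWithin_univ]
  exact (DFunLike.congr_fun (e1.trans (mfderiv_symm hu)) (leftDeriv E G u a)).symm

theorem lie_eq [CompleteSpace E] (a b : LieAlg E G) :
    ⁅a, b⁆ = fderiv ℂ (fun u => leftDeriv E G u b) (origin E G) a -
      fderiv ℂ (fun u => leftDeriv E G u a) (origin E G) b := by
  rw [GroupLieAlgebra.bracket_def, ← VectorField.mlieBracketWithin_univ,
    VectorField.mlieBracketWithin_apply]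
  have hc : mfderiv 𝓘(ℂ, E) 𝓘(ℂ, E) (chart E G) (1 : G) = ContinuousLinearMap.id ℂ E := by
    rw [((contMDiffAt_extChartAt (I := 𝓘(ℂ, E)) (n := ω) (x := (1 : G))).mdifferentiableAt
      (by simp)).mfderiv]
    simp only [modelWithCornersSelf_coe, Set.range_id, fderivWithin_univ]
    have h : writtenInExtChartAt 𝓘(ℂ, E) 𝓘(ℂ, E) (1 : G) (chart E G) =ᶠ[nhds (origin E G)] id :=
      eventually_mem_target.mono fun v hv => (chart E G).right_inv hv
    exact h.fderiv_eq.trans fderiv_id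
  have hV := mpullback_mulInvariantVectorField_eq a
  have hW := mpullback_mulInvariantVectorField_eq b
  have hs : (chart E G).symm ⁻¹' Set.univ ∩ Set.range 𝓘(ℂ, E) = Set.univ := by simp
  have hL : ∀ V W : E → E, V =ᶠ[nhds (origin E G)] (fun u => leftDeriv E G u a) →
      W =ᶠ[nhds (origin E G)] (fun u => leftDeriv E G u b) →
      VectorField.lieBracketWithin ℂ V W
        ((chart E G).symm ⁻¹' Set.univ ∩ Set.range 𝓘(ℂ, E)) (origin E G) =
      fderiv ℂ (fun u => leftDeriv E G u b) (origin E G) a -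
        fderiv ℂ (fun u => leftDeriv E G u a) (origin E G) b := by
    intro V W hV hW
    rw [hs, VectorField.lieBracketWithin_univ, hV.lieBracket_vectorField_eq hW,
      VectorField.lieBracket, leftDeriv_origin]
    rfl
  have hinv : ContinuousLinearMap.inverse (mfderiv 𝓘(ℂ, E) 𝓘(ℂ, E) (chart E G) (1 : G)) =
      ContinuousLinearMap.id ℂ E :=
    (congrArg ContinuousLinearMap.inverse hc).trans ContinuousLinearMap.inverse_id
  exact (DFunLike.congr_fun hinv _).trans (hL _ _ hV hW)

theorem lie_eq_sub [CompleteSpace E] (a b : LieAlg E G) :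
    ⁅a, b⁆ = fderiv ℂ (leftDeriv E G) (origin E G) a b -
      fderiv ℂ (leftDeriv E G) (origin E G) b a := by
  have hd : DifferentiableAt ℂ (leftDeriv E G) (origin E G) :=
    contDiffAt_leftDeriv.differentiableAt (by simp)
  have h : ∀ x y : E, fderiv ℂ (fun u => leftDeriv E G u x) (origin E G) y =
      fderiv ℂ (leftDeriv E G) (origin E G) y x := by
    intro x y
    rw [(hd.hasFDerivAt.clm_apply (hasFDerivAt_const x _)).fderiv]
    simp
  rw [lie_eq]
  exact congrArg₂ _ (h b a) (h a b)

/-! ### The adjoint action and its derivative. -/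

section Adjoint

variable (E) in
/-- The conjugation by `g` in the chart at the identity. -/
noncomputable def conj (g : G) (u : E) : E := chart E G (g * (chart E G).symm u * g⁻¹)

variable (E) in
/-- The adjoint action of `g`, in the chart at the identity. -/
noncomputable def adjoint (g : G) : E →L[ℂ] E := fderiv ℂ (conj E g) (origin E G)

theorem conj_origin (g : G) : conj E g (origin E G) = origin E G := by
  rw [conj, symm_origin, mul_one, mul_inv_cancel]

theorem contMDiffAt_conj_symm {g : G} {u : E} (hu : u ∈ (chart E G).target) :
    ContMDiffAt 𝓘(ℂ, E) 𝓘(ℂ, E) ω (fun v => g * (chart E G).symm v * g⁻¹) u :=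
  (contMDiffAt_const.mul (contMDiffAt_symm hu)).mul contMDiffAt_const

theorem contDiffAt_conj (g : G) : ContDiffAt ℂ ω (conj E g) (origin E G) :=
  (contMDiffAt_conj_symm origin_mem_target).contDiffAt_extChartAt
    (by rw [symm_origin, mul_one, mul_inv_cancel])

theorem hasFDerivAt_conj (g : G) : HasFDerivAt (conj E g) (adjoint E g) (origin E G) :=
  ((contDiffAt_conj g).differentiableAt (by simp)).hasFDerivAt

theorem eventually_symm_conj (g : G) :
    ∀ᶠ u in nhds (origin E G), (chart E G).symm (conj E g u) = g * (chart E G).symm u * g⁻¹ := by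
  have h1 := (contMDiffAt_conj_symm (E := E) (g := g) origin_mem_target).continuousAt
  have h2 : (chart E G).source ∈ nhds (g * (chart E G).symm (origin E G) * g⁻¹) := by
    rw [symm_origin, mul_one, mul_inv_cancel]
    exact extChartAt_source_mem_nhds 1
  filter_upwards [h1.preimage_mem_nhds h2] with p hp
  exact (chart E G).left_inv hp

theorem adjoint_mul (g h : G) : adjoint E (g * h) = adjoint E g ∘L adjoint E h := by
  have h1 : HasFDerivAt (conj E g) (adjoint E g) (conj E h (origin E G)) := by
    rw [conj_origin]
    exact hasFDerivAt_conj g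
  refine ((h1.comp _ (hasFDerivAt_conj h)).congr_of_eventuallyEq ?_).fderiv
  filter_upwards [eventually_symm_conj h] with u hu
  rw [Function.comp_apply, conj, conj, hu, mul_inv_rev]
  simp only [mul_assoc]

theorem adjoint_one : adjoint E (1 : G) = ContinuousLinearMap.id ℂ E := by
  have h : conj E (1 : G) =ᶠ[nhds (origin E G)] id := by
    filter_upwards [eventually_mem_target] with u hu
    rw [conj, one_mul, inv_one, mul_one]
    exact (chart E G).right_inv hu
  rw [adjoint, h.fderiv_eq, fderiv_id]

theorem contMDiffAt_symm_conj_symm :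
    ContMDiffAt 𝓘(ℂ, E × E) 𝓘(ℂ, E) ω (fun p : E × E =>
      (chart E G).symm p.1 * (chart E G).symm p.2 * ((chart E G).symm p.1)⁻¹)
      (origin E G, origin E G) :=
  (contMDiffAt_symm_mul_symm origin_mem_target origin_mem_target).mul
    (ContDiffAt.contMDiffAt_extChartAt_symm contDiffAt_fst origin_mem_target).inv

theorem contDiffAt_conj_symm :
    ContDiffAt ℂ ω (fun p : E × E => conj E ((chart E G).symm p.1) p.2)
      (origin E G, origin E G) :=
  contMDiffAt_symm_conj_symm.contDiffAt_extChartAt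
    (by simp only [symm_origin, mul_one, inv_one])

theorem eventually_symm_conj_symm :
    ∀ᶠ p in nhds (origin E G, origin E G),
      (chart E G).symm (conj E ((chart E G).symm p.1) p.2) =
        (chart E G).symm p.1 * (chart E G).symm p.2 * ((chart E G).symm p.1)⁻¹ := by
  have h1 := (contMDiffAt_symm_conj_symm (E := E) (G := G)).continuousAt
  have h2 : (chart E G).source ∈ nhds ((chart E G).symm (origin E G) *
      (chart E G).symm (origin E G) * ((chart E G).symm (origin E G))⁻¹) := by
    rw [symm_origin, mul_one, inv_one, mul_one]
    exact extChartAt_source_mem_nhds 1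
  filter_upwards [h1.preimage_mem_nhds h2] with p hp
  exact (chart E G).left_inv hp

theorem contDiffAt_adjoint_symm :
    ContDiffAt ℂ ω (fun u => adjoint E ((chart E G).symm u)) (origin E G) := by
  have h1 : ContDiffAt ℂ ω (fderiv ℂ (fun p : E × E => conj E ((chart E G).symm p.1) p.2))
      (origin E G, origin E G) := contDiffAt_conj_symm.fderiv_right (by simp)
  have h2 := h1.comp (f := fun u => (u, origin E G)) (origin E G)
    (contDiffAt_id.prodMk contDiffAt_const)
  refine (h2.clm_comp (contDiffAt_const
    (c := ContinuousLinearMap.inr ℂ E E))).congr_of_eventuallyEq ?_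
  have h3 := ((continuous_id.prodMk continuous_const).continuousAt (x := origin E G)).eventually
    ((contDiffAt_conj_symm (E := E) (G := G)).eventually (by simp))
  filter_upwards [h3] with u hu
  have h4 := (hu.differentiableAt (by simp)).hasFDerivAt
  exact (h4.comp (origin E G) (hasFDerivAt_prodMk_right u (origin E G))).fderiv

/-- This is `d Ad = ad`. Left translation by `u` is conjugation by `u` followed by right translation
by `u`; let `ρ` be the derivative of right translation. The product rule at the identity gives `d Ad
(a) b = dλ(a) b - dρ(a) b` with `λ = leftDeriv`. Symmetry of the second derivative of `mul` turns
`dρ(a) b` into `dλ(b) a`, leaving the bracket of `lie_eq_sub`. -/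
theorem fderiv_adjoint_symm [CompleteSpace E] (a b : LieAlg E G) :
    fderiv ℂ (fun u => adjoint E ((chart E G).symm u)) (origin E G) a b = ⁅a, b⁆ := by
  set e := origin E G
  let ρ : E → E →L[ℂ] E := fun u =>
    fderiv ℂ (mul E G) (e, u) ∘L ContinuousLinearMap.inl ℂ E E
  have hm2 : HasFDerivAt (fderiv ℂ (mul E G)) (fderiv ℂ (fderiv ℂ (mul E G)) (e, e)) (e, e) :=
    ((contDiffAt_mul.fderiv_right (m := ω) (by simp)).differentiableAt (by simp)).hasFDerivAt
  have hρ : ∀ x y, HasFDerivAt ρ (fderiv ℂ ρ e) e ∧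
      fderiv ℂ ρ e x y = fderiv ℂ (fderiv ℂ (mul E G)) (e, e) (0, x) (y, 0) := by
    intro x y
    have h1 := (hm2.comp e (hasFDerivAt_prodMk_right e e)).clm_comp
      (hasFDerivAt_const (ContinuousLinearMap.inl ℂ E E) e)
    refine ⟨h1.differentiableAt.hasFDerivAt, ?_⟩
    have h2 := h1.fderiv
    change fderiv ℂ ρ e = _ at h2
    rw [h2]
    simp
  have hw : ∀ x y, fderiv ℂ (leftDeriv E G) e x y =
      fderiv ℂ (fderiv ℂ (mul E G)) (e, e) (x, 0) (0, y) := by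
    intro x y
    have h1 := (hm2.comp (f := fun u => (u, e)) e (hasFDerivAt_prodMk_left e e)).clm_comp
      (hasFDerivAt_const (ContinuousLinearMap.inr ℂ E E) e)
    have h2 : leftDeriv E G =ᶠ[nhds e] fun u =>
        fderiv ℂ (mul E G) (u, e) ∘L ContinuousLinearMap.inr ℂ E E :=
      eventually_contDiffAt_mul_left.mono fun u hu => leftDeriv_eq hu
    rw [h2.fderiv_eq]
    have h3 := h1.fderiv
    simp only [Function.comp_def] at h3
    rw [h3]
    simp
  have hsymm : ∀ p q, fderiv ℂ (fderiv ℂ (mul E G)) (e, e) p q =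
      fderiv ℂ (fderiv ℂ (mul E G)) (e, e) q p := fun p q =>
    ((contDiffAt_mul (E := E) (G := G)).isSymmSndFDerivAt (by simp)).eq p q
  have hρe : ρ e = ContinuousLinearMap.id ℂ E := by
    have h1 : HasFDerivAt (mul E G) (fderiv ℂ (mul E G) (e, e)) (e, e) :=
      (contDiffAt_mul.differentiableAt (by simp)).hasFDerivAt
    have h2 := (h1.comp (f := fun u => (u, e)) e (hasFDerivAt_prodMk_left e e)).fderiv
    have h3 : (mul E G ∘ fun v => (v, e)) =ᶠ[nhds e] id :=
      eventually_mem_target.mono fun v hv => mul_origin_right hv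
    rw [← fderiv_id (𝕜 := ℂ) (x := e), ← h3.fderiv_eq]
    exact h2.symm
  have key : (fun u => ρ u ∘L adjoint E ((chart E G).symm u)) =ᶠ[nhds e] leftDeriv E G := by
    have hd := ((continuous_const.prodMk continuous_id).continuousAt (x := e)).eventually
      (eventually_contDiffAt_mul (E := E) (G := G))
    have hc := (eventually_symm_conj_symm (E := E) (G := G)).curry_nhds
    filter_upwards [hd, hc] with u hu hcu
    have h1 : HasFDerivAt (mul E G) (fderiv ℂ (mul E G) (e, u))
        (conj E ((chart E G).symm u) e, u) := by
      rw [conj_origin]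
      exact (hu.differentiableAt (by simp)).hasFDerivAt
    have h2 := h1.comp (f := fun v => (conj E ((chart E G).symm u) v, u)) e
      ((hasFDerivAt_conj _).prodMk (hasFDerivAt_const u e))
    have h3 : (fun v => mul E G (u, v)) =ᶠ[nhds e]
        mul E G ∘ fun v => (conj E ((chart E G).symm u) v, u) := by
      filter_upwards [hcu] with v hv
      simp only [mul, Function.comp_apply] at hv ⊢
      rw [hv, inv_mul_cancel_right]
    rw [leftDeriv, h3.fderiv_eq, h2.fderiv]
    ext y
    simp [ρ]
  have hA : HasFDerivAt (fun u => adjoint E ((chart E G).symm u))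
      (fderiv ℂ (fun u => adjoint E ((chart E G).symm u)) e) e :=
    (contDiffAt_adjoint_symm.differentiableAt (by simp)).hasFDerivAt
  have h1 := ((hρ 0 0).1.clm_comp hA).fderiv
  rw [key.fderiv_eq] at h1
  have h2 := DFunLike.congr_fun (DFunLike.congr_fun h1 a) b
  have h3 : adjoint E ((chart E G).symm e) = ContinuousLinearMap.id ℂ E := by
    rw [symm_origin, adjoint_one]
  rw [h3, hρe] at h2
  have h4 : fderiv ℂ (leftDeriv E G) e a b =
      fderiv ℂ (fun u => adjoint E ((chart E G).symm u)) e a b + fderiv ℂ ρ e a b := by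
    exact h2
  rw [lie_eq_sub]
  have h5 : fderiv ℂ (leftDeriv E G) e b a = fderiv ℂ ρ e a b := by
    rw [hw b a, (hρ a b).2]
    exact hsymm _ _
  exact eq_sub_of_add_eq ((congrArg _ h5).trans h4.symm)

end Adjoint

end UnitChart

theorem TensorProduct.eq_of_forall_dual {W : Type*} [AddCommGroup W] [Module ℂ W]
    [FiniteDimensional ℂ W] {t t' : W ⊗[ℂ] W}
    (h : ∀ ξ η : Module.Dual ℂ W, LinearMap.mul' ℂ ℂ (TensorProduct.map ξ η t) =
      LinearMap.mul' ℂ ℂ (TensorProduct.map ξ η t')) : t = t' := by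
  let b := Module.finBasis ℂ W
  have hb : ∀ (t : W ⊗[ℂ] W) i, (b.tensorProduct b).repr t i =
      LinearMap.mul' ℂ ℂ (TensorProduct.map (b.coord i.1) (b.coord i.2) t) := by
    rintro t ⟨i, j⟩
    induction t with
    | zero => simp
    | tmul x y => simp [Module.Basis.tensorProduct_repr_tmul_apply, mul_comm]
    | add x y hx hy => simp only [map_add, Finsupp.add_apply, hx, hy]
  exact (b.tensorProduct b).ext_elem fun i => by rw [hb, hb, h]

/-! ### Invariance of `s` under the connected group. -/

namespace UnitChart

variable {E : Type*} [NormedAddCommGroup E] [NormedSpace ℂ E]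
  {G : Type*} [TopologicalSpace G] [ChartedSpace E G] [Group G] [LieGroup 𝓘(ℂ, E) ω G]

/-- A function with zero derivative along all left-invariant vector fields is locally constant. -/
theorem isLocallyConstant_of_hasFDerivAt_zero {f : G → ℂ}
    (h : ∀ g, HasFDerivAt (fun u => f (g * (chart E G).symm u)) (0 : E →L[ℂ] ℂ) (origin E G)) :
    IsLocallyConstant f := by
  rw [IsLocallyConstant.iff_eventually_eq]
  intro g₀
  set φ := extChartAt 𝓘(ℂ, E) g₀
  have hD : ∀ p ∈ φ.target, HasFDerivAt (fun q => f (φ.symm q)) (0 : E →L[ℂ] ℂ) p := by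
    intro p hp
    -- Translating `p` to the identity makes the hypothesis at `φ.symm p` applicable through the
    -- chain rule.
    have hF : ContMDiffAt 𝓘(ℂ, E) 𝓘(ℂ, E) ω (fun q => (φ.symm p)⁻¹ * φ.symm q) p :=
      contMDiffAt_const.mul
        (ContDiffAt.contMDiffAt_extChartAt_symm (f := fun q : E => q) contDiffAt_id hp)
    have hF1 : (φ.symm p)⁻¹ * φ.symm p = 1 := inv_mul_cancel _
    have h1 : HasFDerivAt (fun u => f (φ.symm p * (chart E G).symm u)) (0 : E →L[ℂ] ℂ)
        (chart E G ((φ.symm p)⁻¹ * φ.symm p)) := by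
      rw [hF1]
      exact h _
    have h2 := ((hF.contDiffAt_extChartAt hF1).differentiableAt (by simp)).hasFDerivAt
    have h3 := h1.comp p h2
    rw [ContinuousLinearMap.zero_comp] at h3
    refine h3.congr_of_eventuallyEq ?_
    have h4 : (chart E G).source ∈ nhds ((φ.symm p)⁻¹ * φ.symm p) := by
      rw [hF1]
      exact extChartAt_source_mem_nhds 1
    filter_upwards [hF.continuousAt.preimage_mem_nhds h4] with q hq
    simp only [Function.comp_apply]
    have h5 : (chart E G).symm (chart E G ((φ.symm p)⁻¹ * φ.symm q)) =
        (φ.symm p)⁻¹ * φ.symm q := (chart E G).left_inv hq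
    rw [h5, mul_inv_cancel_left]
  obtain ⟨r, hr, hball⟩ := Metric.mem_nhds_iff.1 (extChartAt_target_mem_nhds (I := 𝓘(ℂ, E)) g₀)
  have hconst : ∀ p ∈ Metric.ball (φ g₀) r, f (φ.symm p) = f (φ.symm (φ g₀)) := by
    intro p hp
    exact Metric.isOpen_ball.is_const_of_fderiv_eq_zero (𝕜 := ℂ)
      (convex_ball _ _).isPreconnected
      (fun q hq => (hD q (hball hq)).differentiableAt.differentiableWithinAt)
      (fun q hq => (hD q (hball hq)).fderiv) hp (Metric.mem_ball_self hr)
  have h1 := (continuousAt_extChartAt (I := 𝓘(ℂ, E)) g₀).preimage_mem_nhds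
    (Metric.ball_mem_nhds (φ g₀) hr)
  filter_upwards [h1, extChartAt_source_mem_nhds (I := 𝓘(ℂ, E)) g₀] with g hg hgs
  have h2 := hconst (φ g) hg
  rwa [φ.left_inv hgs, φ.left_inv (mem_extChartAt_source g₀)] at h2

instance [FiniteDimensional ℂ E] : FiniteDimensional ℂ (LieAlg E G) :=
  inferInstanceAs (FiniteDimensional ℂ E)

/-- The adjoint action of `g` on the Lie algebra. -/
noncomputable def Ad (g : G) : LieAlg E G →ₗ[ℂ] LieAlg E G := (adjoint E g).toLinearMap

theorem Ad_mul (g h : G) : Ad (E := E) (g * h) = Ad g ∘ₗ Ad h := by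
  rw [Ad, adjoint_mul]
  rfl

theorem exists_hasFDerivAt_Ad_symm [FiniteDimensional ℂ E] (ξ : Module.Dual ℂ (LieAlg E G))
    (b : LieAlg E G) :
    ∃ D : E →L[ℂ] ℂ, HasFDerivAt (fun u => ξ (Ad ((chart E G).symm u) b)) D (origin E G) ∧
      ∀ a : LieAlg E G, D a = ξ ⁅a, b⁆ := by
  have hA : HasFDerivAt (fun u => adjoint E ((chart E G).symm u))
      (fderiv ℂ (fun u => adjoint E ((chart E G).symm u)) (origin E G)) (origin E G) :=
    (contDiffAt_adjoint_symm.differentiableAt (by simp)).hasFDerivAt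
  let ξ' : E →L[ℂ] ℂ := LinearMap.toContinuousLinearMap (𝕜 := ℂ) (E := E) ξ
  let ev : (E →L[ℂ] E) →L[ℂ] ℂ := ξ' ∘L ContinuousLinearMap.apply ℂ E (b : E)
  refine ⟨_, ev.hasFDerivAt.comp (origin E G) hA, fun a => ?_⟩
  exact congrArg ξ (fderiv_adjoint_symm a b)

/-- Because `Ad (k u) = Ad k ∘ Ad u`, the derivative of each coefficient of `(Ad k ⊗ Ad k) s` in a
left-invariant direction `a` is a coefficient of `⁅a, s⁆ = 0`. The coefficients are thus locally
constant, and connectedness compares them with their value at `1`. -/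
theorem map_Ad_of_invariant [FiniteDimensional ℂ E] [ConnectedSpace G]
    {s : LieAlg E G ⊗[ℂ] LieAlg E G} (hs : ∀ x : LieAlg E G, ⁅x, s⁆ = 0) (g : G) :
    TensorProduct.map (Ad g) (Ad g) s = s := by
  have hone : Ad (E := E) (1 : G) = LinearMap.id := by
    rw [Ad, adjoint_one]
    rfl
  refine TensorProduct.eq_of_forall_dual fun ξ η => ?_
  obtain ⟨S, hS⟩ := TensorProduct.exists_finset s
  have hval : ∀ (ξ η : Module.Dual ℂ (LieAlg E G)) (k : G),
      LinearMap.mul' ℂ ℂ (TensorProduct.map ξ η (TensorProduct.map (Ad k) (Ad k) s)) =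
      ∑ i ∈ S, ξ (Ad k i.1) * η (Ad k i.2) := by
    intro ξ η k
    rw [hS]
    simp
  have hconst : IsLocallyConstant fun k : G =>
      LinearMap.mul' ℂ ℂ (TensorProduct.map ξ η (TensorProduct.map (Ad k) (Ad k) s)) := by
    refine isLocallyConstant_of_hasFDerivAt_zero (E := E) fun k => ?_
    have hfun : ∀ u, LinearMap.mul' ℂ ℂ (TensorProduct.map ξ η
        (TensorProduct.map (Ad (k * (chart E G).symm u)) (Ad (k * (chart E G).symm u)) s)) =
        ∑ i ∈ S, (ξ ∘ₗ Ad k) (Ad ((chart E G).symm u) i.1) *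
          (η ∘ₗ Ad k) (Ad ((chart E G).symm u) i.2) := by
      intro u
      rw [hval]
      refine Finset.sum_congr rfl fun i _ => ?_
      rw [Ad_mul]
      rfl
    simp only [hfun]
    choose D hD hDa using fun (θ : Module.Dual ℂ (LieAlg E G)) (b : LieAlg E G) =>
      exists_hasFDerivAt_Ad_symm (θ ∘ₗ Ad k) b
    have h1 := HasFDerivAt.fun_sum (u := S) fun i _ => (hD ξ i.1).mul (hD η i.2)
    refine h1.congr_fderiv (ContinuousLinearMap.ext fun a => ?_)
    have h2 : ∀ a : LieAlg E G, ∑ i ∈ S,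
        ((ξ ∘ₗ Ad k) i.1 * D η i.2 a + (η ∘ₗ Ad k) i.2 * D ξ i.1 a) = 0 := by
      intro a
      have h3 : LinearMap.mul' ℂ ℂ (TensorProduct.map (ξ ∘ₗ Ad k) (η ∘ₗ Ad k) ⁅a, s⁆) = 0 := by
        rw [hs, map_zero, map_zero]
      rw [hS, lie_sum] at h3
      simp only [TensorProduct.LieModule.lie_tmul_right, map_sum, map_add, TensorProduct.map_tmul,
        LinearMap.mul'_apply] at h3
      refine Eq.trans (Finset.sum_congr rfl fun i _ => ?_) h3
      rw [hDa ξ i.1 a, hDa η i.2 a]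
      ring
    rw [symm_origin, hone]
    simpa using h2 a
  have h := hconst.apply_eq_of_preconnectedSpace g 1
  simpa [hone] using h

end UnitChart

/-! ### The derivative of `(a, b) ↦ a⁻¹ g b`. -/

namespace UnitChart

variable {E : Type*} [NormedAddCommGroup E] [NormedSpace ℂ E]
  {G : Type*} [TopologicalSpace G] [ChartedSpace E G] [Group G] [LieGroup 𝓘(ℂ, E) ω G]

theorem fderiv_mul_origin (x y : E) :
    fderiv ℂ (mul E G) (origin E G, origin E G) (x, y) = x + y := by
  have h1 : HasFDerivAt (mul E G) (fderiv ℂ (mul E G) (origin E G, origin E G))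
      (origin E G, origin E G) := (contDiffAt_mul.differentiableAt (by simp)).hasFDerivAt
  have hl := (h1.comp (f := fun u => (u, origin E G)) (origin E G)
    (hasFDerivAt_prodMk_left _ _)).congr_of_eventuallyEq (f₁ := id)
    (eventually_mem_target.mono fun v hv => (mul_origin_right hv).symm)
  have hr := (h1.comp (f := fun u => (origin E G, u)) (origin E G)
    (hasFDerivAt_prodMk_right _ _)).congr_of_eventuallyEq (f₁ := id)
    (eventually_mem_target.mono fun v hv => (mul_origin_left hv).symm)
  have hl' := DFunLike.congr_fun (hl.unique (hasFDerivAt_id _)) x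
  have hr' := DFunLike.congr_fun (hr.unique (hasFDerivAt_id _)) y
  simp only [ContinuousLinearMap.comp_apply, ContinuousLinearMap.inl_apply,
    ContinuousLinearMap.inr_apply, ContinuousLinearMap.id_apply] at hl' hr'
  have h2 : ((x, y) : E × E) = (x, 0) + (0, y) := by simp
  rw [h2, map_add, hl', hr']

/-- The inversion has derivative `-1` at the identity. -/
theorem hasFDerivAt_inv :
    HasFDerivAt (fun u => chart E G ((chart E G).symm u)⁻¹) (-ContinuousLinearMap.id ℂ E)
      (origin E G) := by
  have h1 : HasFDerivAt (mul E G) (fderiv ℂ (mul E G) (origin E G, origin E G))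
      (origin E G, origin E G) := (contDiffAt_mul.differentiableAt (by simp)).hasFDerivAt
  have hi : ContMDiffAt 𝓘(ℂ, E) 𝓘(ℂ, E) ω (fun u => ((chart E G).symm u)⁻¹) (origin E G) :=
    (contMDiffAt_symm origin_mem_target).inv
  have hi1 : ((chart E G).symm (origin E G))⁻¹ = 1 := by rw [symm_origin, inv_one]
  have hd := ((hi.contDiffAt_extChartAt hi1).differentiableAt (by simp)).hasFDerivAt
  have h1' : HasFDerivAt (mul E G) (fderiv ℂ (mul E G) (origin E G, origin E G))
      (origin E G, chart E G ((chart E G).symm (origin E G))⁻¹) := by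
    rw [hi1]
    exact h1
  have h2 := h1'.comp (f := fun u => (u, chart E G ((chart E G).symm u)⁻¹)) (origin E G)
    ((hasFDerivAt_id _).prodMk hd)
  have h3 : (fun _ => origin E G) =ᶠ[nhds (origin E G)]
      mul E G ∘ fun u => (u, chart E G ((chart E G).symm u)⁻¹) := by
    have h4 : (chart E G).source ∈ nhds ((chart E G).symm (origin E G))⁻¹ := by
      rw [hi1]
      exact extChartAt_source_mem_nhds 1
    filter_upwards [hi.continuousAt.preimage_mem_nhds h4] with u hu
    have h5 : (chart E G).symm (chart E G ((chart E G).symm u)⁻¹) = ((chart E G).symm u)⁻¹ :=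
      (chart E G).left_inv hu
    rw [Function.comp_apply, mul, h5, mul_inv_cancel]
  have h6 := (h2.congr_of_eventuallyEq h3).unique (hasFDerivAt_const _ _)
  refine hd.congr_fderiv (ContinuousLinearMap.ext fun x => ?_)
  have h7 := DFunLike.congr_fun h6 x
  simp only [ContinuousLinearMap.comp_apply, ContinuousLinearMap.prod_apply,
    ContinuousLinearMap.id_apply, fderiv_mul_origin, zero_apply] at h7
  rw [neg_apply, ContinuousLinearMap.id_apply]
  exact (neg_eq_of_add_eq_zero_right h7).symm

variable (E) in
/-- The map `(a, b) ↦ a⁻¹ g b`, in the charts at the identity and at `g`. -/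
noncomputable def twoSided (g : G) (p : E × E) : E :=
  extChartAt 𝓘(ℂ, E) g (((chart E G).symm p.1)⁻¹ * g * (chart E G).symm p.2)

theorem contDiffAt_twoSided (g : G) :
    ContDiffAt ℂ ω (twoSided E g) (origin E G, origin E G) := by
  have h : ContMDiffAt 𝓘(ℂ, E × E) 𝓘(ℂ, E) ω
      (fun p : E × E => ((chart E G).symm p.1)⁻¹ * g * (chart E G).symm p.2)
      (origin E G, origin E G) :=
    ((ContDiffAt.contMDiffAt_extChartAt_symm contDiffAt_fst origin_mem_target).inv.mul
      contMDiffAt_const).mul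
      (ContDiffAt.contMDiffAt_extChartAt_symm contDiffAt_snd origin_mem_target)
  exact h.contDiffAt_extChartAt (by simp only [symm_origin, inv_one, one_mul, mul_one])

theorem hasFDerivAt_twoSided (g : G) :
    HasFDerivAt (twoSided E g) (fderiv ℂ (twoSided E g) (origin E G, origin E G))
      (origin E G, origin E G) :=
  ((contDiffAt_twoSided g).differentiableAt (by simp)).hasFDerivAt

/-- Write `g b = ((g b g⁻¹)⁻¹)⁻¹ g`: moving the right factor to the left slot costs a conjugation by
`g` and an inversion, whose derivatives are `Ad` and `-1`. -/
theorem fderiv_twoSided_right (g : G) (y : E) :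
    fderiv ℂ (twoSided E g) (origin E G, origin E G) (0, y) =
      -fderiv ℂ (twoSided E g) (origin E G, origin E G) (adjoint E g y, 0) := by
  have hi : HasFDerivAt (fun u => chart E G ((chart E G).symm u)⁻¹) (-ContinuousLinearMap.id ℂ E)
      (conj E g (origin E G)) := by
    rw [conj_origin]
    exact hasFDerivAt_inv
  have h1 := hi.comp (origin E G) (hasFDerivAt_conj g)
  have h2 : HasFDerivAt (twoSided E g) (fderiv ℂ (twoSided E g) (origin E G, origin E G))
      (chart E G ((chart E G).symm (conj E g (origin E G)))⁻¹, origin E G) := by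
    rw [conj_origin, symm_origin, inv_one]
    exact hasFDerivAt_twoSided g
  have h3 := h2.comp
    (f := fun u => (chart E G ((chart E G).symm (conj E g u))⁻¹, origin E G)) (origin E G)
    (h1.prodMk (hasFDerivAt_const _ _))
  have h4 := (hasFDerivAt_twoSided g).comp (f := fun u => (origin E G, u)) (origin E G)
    (hasFDerivAt_prodMk_right _ _)
  have h5 : (twoSided E g ∘ fun u => (origin E G, u)) =ᶠ[nhds (origin E G)]
      twoSided E g ∘ fun u => (chart E G ((chart E G).symm (conj E g u))⁻¹, origin E G) := by
    have hc : ContinuousAt (fun u => (g * (chart E G).symm u * g⁻¹)⁻¹) (origin E G) :=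
      (contMDiffAt_conj_symm (E := E) (g := g) origin_mem_target).inv.continuousAt
    have h6 : (chart E G).source ∈ nhds (g * (chart E G).symm (origin E G) * g⁻¹)⁻¹ := by
      rw [symm_origin, mul_one, mul_inv_cancel, inv_one]
      exact extChartAt_source_mem_nhds 1
    filter_upwards [eventually_symm_conj g, hc.preimage_mem_nhds h6] with u hu hu'
    have h7 : (chart E G).symm (chart E G (g * (chart E G).symm u * g⁻¹)⁻¹) =
        (g * (chart E G).symm u * g⁻¹)⁻¹ := (chart E G).left_inv hu'
    simp only [Function.comp_apply, twoSided, hu, h7, symm_origin]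
    congr 1
    group
  have h8 := DFunLike.congr_fun ((h3.congr_of_eventuallyEq h5).unique h4) y
  simp only [ContinuousLinearMap.comp_apply, ContinuousLinearMap.prod_apply,
    ContinuousLinearMap.inr_apply, neg_apply, ContinuousLinearMap.id_apply,
    zero_apply] at h8
  have h9 : ((-adjoint E g y, 0) : E × E) = -(adjoint E g y, 0) := by simp
  rw [← h8, h9, map_neg]

end UnitChart

/-! ### The infinitesimal gauge action in coordinates. -/

section Gauge

open UnitChart

variable {E : Type*} [NormedAddCommGroup E] [NormedSpace ℂ E]
  {G : Type*} [TopologicalSpace G] [ChartedSpace E G] [Group G]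
  {Edge : Type*} [Fintype Edge]

theorem gaugeAction_one (g : Edge → G) : gaugeAction g 1 = g := by
  funext γ
  simp [gaugeAction]

/-- The inverse of the chart of `G^J` at the identity. -/
noncomputable def powSymm (E : Type*) [NormedAddCommGroup E] [NormedSpace ℂ E] {G J : Type*}
    [TopologicalSpace G] [ChartedSpace E G] [Group G] (u : J → E) : J → G :=
  fun j => (chart E G).symm (u j)

variable (E G) in
/-- The coordinates of the identity of `G^J`. -/
noncomputable abbrev powOrigin (J : Type*) : J → E := fun _ => origin E G

theorem powSymm_origin (J : Type*) : powSymm E (powOrigin E G J) = (1 : J → G) :=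
  funext fun _ => symm_origin

variable [LieGroup 𝓘(ℂ, E) ω G]

theorem contMDiffAt_gaugeAction_powSymm {X : Type*} [NormedAddCommGroup X] [NormedSpace ℂ X]
    {p : X → Edge → G} {u : X → HalfEdge Edge → E} {x : X}
    (hp : ContMDiffAt 𝓘(ℂ, X) (powModel E Edge) ω p x) (hu : ContDiffAt ℂ ω u x)
    (hux : u x = powOrigin E G _) :
    ContMDiffAt 𝓘(ℂ, X) (powModel E Edge) ω (fun y => gaugeAction (p y) (powSymm E (u y))) x := by
  refine contMDiffAt_powModel fun γ => ?_
  have hc : ∀ α, ContMDiffAt 𝓘(ℂ, X) 𝓘(ℂ, E) ω (fun y => (chart E G).symm (u y α)) x := by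
    intro α
    refine ContDiffAt.contMDiffAt_extChartAt_symm (contDiffAt_pi.1 hu α) ?_
    rw [hux]
    exact origin_mem_target
  exact ((hc (Sum.inl γ)).inv.mul (((contMDiff_proj γ).contMDiffAt).comp x hp)).mul (hc (Sum.inr γ))

theorem contMDiff_gaugeAction (g : Edge → G) :
    ContMDiff (powModel E (HalfEdge Edge)) (powModel E Edge) ω (gaugeAction g) := by
  intro h
  refine contMDiffAt_powModel fun γ => ?_
  exact ((contMDiff_proj (Sum.inl γ)).contMDiffAt.inv.mul contMDiffAt_const).mul
    (contMDiff_proj (Sum.inr γ)).contMDiffAt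

theorem gaugeField_apply (g : Edge → G) (x : HalfEdge Edge → LieAlg E G) :
    gaugeField E G g x = fun γ : Edge =>
      fderiv ℂ (twoSided E (g γ)) (origin E G, origin E G) (x (Sum.inl γ), x (Sum.inr γ)) := by
  have h1 : mfderiv (powModel E (HalfEdge Edge)) (powModel E Edge) (gaugeAction g)
      (1 : HalfEdge Edge → G) =
      fderiv ℂ (fun (u : HalfEdge Edge → E) (γ : Edge) =>
        twoSided E (g γ) (u (Sum.inl γ), u (Sum.inr γ))) (powOrigin E G _) := by
    rw [((contMDiff_gaugeAction g).mdifferentiableAt (by simp)).mfderiv, range_powModel,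
      fderivWithin_univ]
    simp only [writtenInExtChartAt, gaugeAction_one]
    rfl
  have h2 : HasFDerivAt (fun (u : HalfEdge Edge → E) (γ : Edge) =>
      twoSided E (g γ) (u (Sum.inl γ), u (Sum.inr γ)))
      (ContinuousLinearMap.pi fun γ =>
        fderiv ℂ (twoSided E (g γ)) (origin E G, origin E G) ∘L
          ((ContinuousLinearMap.proj (R := ℂ) (φ := fun _ : HalfEdge Edge => E) (Sum.inl γ)).prod
            (ContinuousLinearMap.proj (Sum.inr γ)))) (powOrigin E G _) := by
    refine hasFDerivAt_pi.2 fun γ => ?_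
    exact (hasFDerivAt_twoSided (g γ)).comp
      (f := fun u : HalfEdge Edge → E => (u (Sum.inl γ), u (Sum.inr γ))) (powOrigin E G _)
      ((hasFDerivAt_apply (𝕜 := ℂ) (Sum.inl γ) _).prodMk (hasFDerivAt_apply (Sum.inr γ) _))
  exact DFunLike.congr_fun (h1.trans h2.fderiv) (x : HalfEdge Edge → E)

end Gauge

theorem TensorProduct.map_neg_neg {R A B : Type*} [CommRing R] [AddCommGroup A] [Module R A]
    [AddCommGroup B] [Module R B] (f : A →ₗ[R] B) :
    TensorProduct.map (-f) (-f) = TensorProduct.map f f :=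
  TensorProduct.ext' fun x y => by simp [TensorProduct.neg_tmul, TensorProduct.tmul_neg]

theorem TensorProduct.mul'_map_comm {R A : Type*} [CommRing R] [AddCommGroup A] [Module R A]
    (f g : A →ₗ[R] R) (t : A ⊗[R] A) :
    LinearMap.mul' R R (TensorProduct.map f g (TensorProduct.comm R A A t)) =
      LinearMap.mul' R R (TensorProduct.map g f t) := by
  induction t with
  | zero => simp
  | tmul x y => simp [mul_comm]
  | add x y hx hy => simp only [map_add, hx, hy]

theorem TensorProduct.mul'_map_of_comm_eq_neg {R A : Type*} [CommRing R] [AddCommGroup A]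
    [Module R A] (f g : A →ₗ[R] R) {t : A ⊗[R] A} (ht : TensorProduct.comm R A A t = -t) :
    LinearMap.mul' R R (TensorProduct.map f g t) =
      -LinearMap.mul' R R (TensorProduct.map g f t) := by
  rw [← TensorProduct.mul'_map_comm, ht, map_neg, map_neg]

theorem TensorProduct.map_self_add_comm {R A B : Type*} [CommRing R] [AddCommGroup A]
    [Module R A] [AddCommGroup B] [Module R B] (f : A →ₗ[R] B) (t : A ⊗[R] A) :
    TensorProduct.map f f t + TensorProduct.comm R B B (TensorProduct.map f f t) =
      TensorProduct.map f f (t + TensorProduct.comm R A A t) := by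
  rw [map_add, TensorProduct.map_comm]

theorem TensorProduct.map_smul_sum_sub_eq_zero {R A B ι : Type*} [CommRing R] [AddCommGroup A]
    [Module R A] [AddCommGroup B] [Module R B] (f : A →ₗ[R] B) (c : R) (S : Finset ι)
    {t t' : ι → A ⊗[R] A}
    (h : ∀ i, TensorProduct.map f f (t i) = TensorProduct.map f f (t' i)) :
    TensorProduct.map f f (c • ∑ i ∈ S, (t i - t' i)) = 0 := by
  rw [map_smul, map_sum, Finset.sum_eq_zero fun i _ => ?_, smul_zero]
  rw [map_sub, h, sub_self]

/-! ### Antisymmetry, and the gauge action by derivations. -/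

section Gauge

open UnitChart RMatrix

variable {E : Type*} [NormedAddCommGroup E] [NormedSpace ℂ E]
  {G : Type*} [TopologicalSpace G] [ChartedSpace E G] [Group G] [LieGroup 𝓘(ℂ, E) ω G]
  {Edge : Type*} [Fintype Edge]

/-- By `fderiv_twoSided_right`, the end half edge acts as `-A ∘ Ad (g γ)`, where `A` is the action
of the source half edge. The two signs cancel in the 2-tensor, and `s` absorbs `Ad`. -/
theorem gaugeTensor_source_eq_target [FiniteDimensional ℂ E] [ConnectedSpace G] [DecidableEq Edge]
    {s : LieAlg E G ⊗[ℂ] LieAlg E G} (hs : ∀ x : LieAlg E G, ⁅x, s⁆ = 0) (g : Edge → G)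
    (γ : Edge) :
    gaugeTensor E G (at₂ (Sum.inl γ : HalfEdge Edge) s) g =
      gaugeTensor E G (at₂ (Sum.inr γ : HalfEdge Edge) s) g := by
  set A := gaugeField E G g ∘ₗ
    LinearMap.single ℂ (fun _ : HalfEdge Edge => LieAlg E G) (Sum.inl γ)
  have key : ∀ (y : E) (δ : Edge),
      fderiv ℂ (twoSided E (g δ)) (origin E G, origin E G)
        ((Pi.single (Sum.inr γ) y : HalfEdge Edge → E) (Sum.inl δ),
          (Pi.single (Sum.inr γ) y : HalfEdge Edge → E) (Sum.inr δ)) =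
      -fderiv ℂ (twoSided E (g δ)) (origin E G, origin E G)
        ((Pi.single (Sum.inl γ) (adjoint E (g γ) y) : HalfEdge Edge → E) (Sum.inl δ),
          (Pi.single (Sum.inl γ) (adjoint E (g γ) y) : HalfEdge Edge → E) (Sum.inr δ)) := by
    intro y δ
    by_cases hδ : δ = γ
    · subst hδ
      simpa using fderiv_twoSided_right (g δ) y
    · have h1 : (Sum.inl δ : HalfEdge Edge) ≠ Sum.inl γ := fun h => hδ (Sum.inl_injective h)
      have h2 : (Sum.inr δ : HalfEdge Edge) ≠ Sum.inr γ := fun h => hδ (Sum.inr_injective h)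
      rw [Pi.single_eq_of_ne h1, Pi.single_eq_of_ne h2, Pi.single_eq_of_ne (by simp),
        Pi.single_eq_of_ne (by simp), Prod.mk_zero_zero, map_zero, neg_zero]
  have h : gaugeField E G g ∘ₗ
      LinearMap.single ℂ (fun _ : HalfEdge Edge => LieAlg E G) (Sum.inr γ) = (-A) ∘ₗ Ad (g γ) := by
    refine LinearMap.ext fun y => ?_
    have hl := gaugeField_apply (E := E) g
      (Pi.single (Sum.inl γ) (Ad (g γ) y) : HalfEdge Edge → LieAlg E G)
    have hr := gaugeField_apply (E := E) g (Pi.single (Sum.inr γ) y : HalfEdge Edge → LieAlg E G)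
    refine hr.trans (Eq.trans ?_ (congrArg (fun v : Edge → E => -v) hl).symm)
    exact funext fun δ => key y δ
  have e1 : gaugeTensor E G (at₂ (Sum.inl γ : HalfEdge Edge) s) g = TensorProduct.map A A s := by
    rw [gaugeTensor, at₂, ← LinearMap.comp_apply, ← TensorProduct.map_comp]
  have e2 : gaugeTensor E G (at₂ (Sum.inr γ : HalfEdge Edge) s) g =
      TensorProduct.map ((-A) ∘ₗ Ad (g γ)) ((-A) ∘ₗ Ad (g γ)) s := by
    rw [gaugeTensor, at₂, ← LinearMap.comp_apply, ← TensorProduct.map_comp, h]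
  have e3 : ∀ B : LieAlg E G →ₗ[ℂ] TangentSpace (powModel E Edge) g,
      TensorProduct.map ((-B) ∘ₗ Ad (g γ)) ((-B) ∘ₗ Ad (g γ)) s = TensorProduct.map B B s := by
    intro B
    rw [TensorProduct.map_comp, TensorProduct.map_neg_neg, LinearMap.comp_apply,
      map_Ad_of_invariant hs]
  exact e1.trans (e2.trans (e3 A)).symm

/-- The derivative of `f` at `g` along the infinitesimal gauge action. -/
noncomputable def gaugeDeriv (f : (Edge → G) → ℂ) (g : Edge → G) :
    Module.Dual ℂ (HalfEdge Edge → LieAlg E G) :=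
  differential (powModel E Edge) f g ∘ₗ gaugeField E G g

theorem tensorBracket_gaugeTensor (r : (HalfEdge Edge → LieAlg E G) ⊗[ℂ] (HalfEdge Edge → LieAlg E G))
    (f h : (Edge → G) → ℂ) (g : Edge → G) :
    tensorBracket (powModel E Edge) (gaugeTensor E G r) f h g =
      LinearMap.mul' ℂ ℂ (TensorProduct.map (gaugeDeriv (E := E) f g) (gaugeDeriv h g) r) := by
  rw [tensorBracket, gaugeTensor, ← LinearMap.comp_apply (TensorProduct.map _ _),
    ← TensorProduct.map_comp]
  rfl

theorem gaugeDeriv_neg (f : (Edge → G) → ℂ) (g : Edge → G) :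
    gaugeDeriv (E := E) (fun q => -f q) g = -gaugeDeriv f g := by
  have h : mfderiv (powModel E Edge) 𝓘(ℂ, ℂ) (fun q => -f q) g =
      -mfderiv (powModel E Edge) 𝓘(ℂ, ℂ) f g := mfderiv_neg
  refine LinearMap.ext fun x => ?_
  exact DFunLike.congr_fun h (gaugeField E G g x)

theorem gaugeDeriv_apply {f : (Edge → G) → ℂ} {g : Edge → G}
    (hf : MDifferentiableAt (powModel E Edge) 𝓘(ℂ, ℂ) f g) (x : HalfEdge Edge → LieAlg E G) :
    gaugeDeriv f g x =
      fderiv ℂ (fun u : HalfEdge Edge → E => f (gaugeAction g (powSymm E u)))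
        (powOrigin E G _) x := by
  have h1 := ((contMDiff_gaugeAction (E := E) g).mdifferentiableAt (x := 1)
    (by simp)).hasMFDerivAt
  -- The points `gaugeAction g 1` and `g` agree only propositionally, so the derivative of `f` is
  -- transported along an equality of points.
  have h2 : ∀ g', g' = g → HasMFDerivAt (powModel E Edge) 𝓘(ℂ, ℂ) f g'
      (mfderiv (powModel E Edge) 𝓘(ℂ, ℂ) f g : (Edge → E) →L[ℂ] ℂ) := by
    rintro _ rfl
    exact hf.hasMFDerivAt
  have h3 := ((h2 _ (gaugeAction_one g)).comp 1 h1).2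
  rw [range_powModel] at h3
  obtain ⟨D, hD, hDx⟩ : ∃ D : (HalfEdge Edge → E) →L[ℂ] ℂ,
      HasFDerivAt (fun u : HalfEdge Edge → E => f (gaugeAction g (powSymm E u))) D
        (powOrigin E G _) ∧ ∀ y : HalfEdge Edge → E, gaugeDeriv f g y = D y :=
    ⟨_, hasFDerivWithinAt_univ.1 h3, fun _ => rfl⟩
  rw [hD.fderiv]
  exact hDx x

theorem contDiffAt_comp_gaugeAction {X : Type*} [NormedAddCommGroup X] [NormedSpace ℂ X]
    {f : (Edge → G) → ℂ} {p : X → Edge → G} {u : X → HalfEdge Edge → E} {x : X}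
    (hf : ContMDiffAt (powModel E Edge) 𝓘(ℂ, ℂ) ω f (p x))
    (hp : ContMDiffAt 𝓘(ℂ, X) (powModel E Edge) ω p x) (hu : ContDiffAt ℂ ω u x)
    (hux : u x = powOrigin E G _) :
    ContDiffAt ℂ ω (fun y => f (gaugeAction (p y) (powSymm E (u y)))) x := by
  have h1 := contMDiffAt_gaugeAction_powSymm hp hu hux
  have h2 : gaugeAction (p x) (powSymm E (u x)) = p x := by
    rw [hux, powSymm_origin, gaugeAction_one]
  rw [← contMDiffAt_iff_contDiffAt]
  refine ContMDiffAt.comp x (g := f) ?_ h1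
  rw [h2]
  exact hf

theorem contDiffAt_gaugeAction {f : (Edge → G) → ℂ} {g : Edge → G}
    (hf : ContMDiffAt (powModel E Edge) 𝓘(ℂ, ℂ) ω f g) :
    ContDiffAt ℂ ω (fun u : HalfEdge Edge → E => f (gaugeAction g (powSymm E u)))
      (powOrigin E G _) :=
  contDiffAt_comp_gaugeAction (p := fun _ => g) (u := fun u => u) hf contMDiffAt_const
    contDiffAt_id rfl

theorem hasFDerivAt_gaugeAction {f : (Edge → G) → ℂ} {g : Edge → G}
    (hf : ContMDiffAt (powModel E Edge) 𝓘(ℂ, ℂ) ω f g) :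
    HasFDerivAt (fun u : HalfEdge Edge → E => f (gaugeAction g (powSymm E u)))
      (fderiv ℂ (fun u : HalfEdge Edge → E => f (gaugeAction g (powSymm E u)))
        (powOrigin E G _)) (powOrigin E G _) :=
  ((contDiffAt_gaugeAction hf).differentiableAt (by simp)).hasFDerivAt

theorem gaugeDeriv_eq {f : (Edge → G) → ℂ} {g : Edge → G}
    (hf : ContMDiffAt (powModel E Edge) 𝓘(ℂ, ℂ) ω f g) {D : (HalfEdge Edge → E) →L[ℂ] ℂ}
    (hD : HasFDerivAt (fun u : HalfEdge Edge → E => f (gaugeAction g (powSymm E u))) D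
      (powOrigin E G _)) (x : HalfEdge Edge → LieAlg E G) :
    gaugeDeriv f g x = D x := by
  rw [gaugeDeriv_apply (hf.mdifferentiableAt (by simp)), hD.fderiv]

theorem gaugeDeriv_mul {f h : (Edge → G) → ℂ} {g : Edge → G}
    (hf : ContMDiffAt (powModel E Edge) 𝓘(ℂ, ℂ) ω f g)
    (hh : ContMDiffAt (powModel E Edge) 𝓘(ℂ, ℂ) ω h g) :
    gaugeDeriv (E := E) (fun q => f q * h q) g = f g • gaugeDeriv h g + h g • gaugeDeriv f g := by
  refine LinearMap.ext fun x => ?_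
  have h1 := (hasFDerivAt_gaugeAction hf).mul (hasFDerivAt_gaugeAction hh)
  rw [powSymm_origin, gaugeAction_one] at h1
  refine (gaugeDeriv_eq (hf.mul hh) h1 x).trans ?_
  rw [LinearMap.add_apply, LinearMap.smul_apply, LinearMap.smul_apply,
    gaugeDeriv_eq hf (hasFDerivAt_gaugeAction hf), gaugeDeriv_eq hh (hasFDerivAt_gaugeAction hh)]
  rfl

theorem gaugeDeriv_sum {ι : Type*} (S : Finset ι) {F : ι → (Edge → G) → ℂ} {g : Edge → G}
    (hF : ∀ i, ContMDiffAt (powModel E Edge) 𝓘(ℂ, ℂ) ω (F i) g) :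
    gaugeDeriv (E := E) (fun q => ∑ i ∈ S, F i q) g = ∑ i ∈ S, gaugeDeriv (F i) g := by
  refine LinearMap.ext fun x => ?_
  have h1 := HasFDerivAt.fun_sum (u := S) fun i _ => hasFDerivAt_gaugeAction (hF i)
  refine (gaugeDeriv_eq (contMDiffAt_finsetSum fun i _ => hF i) h1 x).trans ?_
  rw [LinearMap.sum_apply]
  have h2 : ∀ y : HalfEdge Edge → E,
      (∑ i ∈ S, fderiv ℂ (fun u : HalfEdge Edge → E => F i (gaugeAction g (powSymm E u)))
        (powOrigin E G _)) y =
      ∑ i ∈ S, fderiv ℂ (fun u : HalfEdge Edge → E => F i (gaugeAction g (powSymm E u)))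
        (powOrigin E G _) y := fun y => sum_apply _ _ _
  exact (h2 x).trans (Finset.sum_congr rfl fun i _ =>
    (gaugeDeriv_eq (hF i) (hasFDerivAt_gaugeAction (hF i)) x).symm)

/-- The derivative is the partial derivative, in the group variable at the identity, of the function
`Ψ`, analytic jointly in the point and the group variable; it is therefore analytic in the point. -/
theorem contMDiffOn_gaugeDeriv {f : (Edge → G) → ℂ} {U : Set (Edge → G)} (hU : IsOpen U)
    (hf : ContMDiffOn (powModel E Edge) 𝓘(ℂ, ℂ) ω f U) (x : HalfEdge Edge → LieAlg E G) :
    ContMDiffOn (powModel E Edge) 𝓘(ℂ, ℂ) ω (fun g => gaugeDeriv f g x) U := by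
  intro g₀ hg₀
  refine ContMDiffAt.contMDiffWithinAt ?_
  set φ := extChartAt (powModel E Edge) g₀ with hφ
  let Ψ : (Edge → E) × (HalfEdge Edge → E) → ℂ := fun p =>
    f (gaugeAction (φ.symm p.1) (powSymm E p.2))
  have hφs : φ.symm (φ g₀) = g₀ := φ.left_inv (mem_extChartAt_source g₀)
  have hΨ : ContDiffAt ℂ ω Ψ (φ g₀, powOrigin E G _) := by
    refine contDiffAt_comp_gaugeAction (p := fun p : (Edge → E) × (HalfEdge Edge → E) => φ.symm p.1)
      (u := fun p => p.2) ?_ ?_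
      contDiffAt_snd rfl
    · simp only [hφs]
      exact hf.contMDiffAt (hU.mem_nhds hg₀)
    · refine contMDiffAt_powModel fun γ => ?_
      exact ContDiffAt.contMDiffAt_extChartAt_symm (f := fun p : (Edge → E) × _ => p.1 γ)
        (contDiffAt_pi.1 contDiffAt_fst γ) (mem_extChartAt_target (g₀ γ))
  have hcont := (contMDiffAt_extChartAt_powModel (E := E) g₀)
  have h1 : ContDiffAt ℂ ω (fun p => fderiv ℂ Ψ (p, powOrigin E G _)
      ((0, x) : (Edge → E) × (HalfEdge Edge → E))) (φ g₀) := by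
    have h2 : ContDiffAt ℂ ω (fderiv ℂ Ψ) (φ g₀, powOrigin E G _) := hΨ.fderiv_right (by simp)
    exact (h2.comp (f := fun p => (p, powOrigin E G _)) (φ g₀)
      (contDiffAt_id.prodMk contDiffAt_const)).clm_apply contDiffAt_const
  have h3 := (contMDiffAt_iff_contDiffAt.2 h1).comp g₀ hcont
  refine h3.congr_of_eventuallyEq ?_
  have hd : ∀ᶠ g in nhds g₀, ContDiffAt ℂ ω Ψ (φ g, powOrigin E G _) :=
    (hcont.continuousAt.prodMk continuousAt_const).eventually (hΨ.eventually (by simp))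
  filter_upwards [hd, hU.mem_nhds hg₀, extChartAt_powModel_source_mem_nhds (E := E) g₀]
    with g hg hgU hgs
  have h4 := ((hg.differentiableAt (by simp)).hasFDerivAt.comp (f := fun u => (φ g, u))
    (powOrigin E G _) (hasFDerivAt_prodMk_right _ _))
  have h5 : (Ψ ∘ fun u => (φ g, u)) = fun u => f (gaugeAction g (powSymm E u)) := by
    funext u
    simp only [Function.comp_apply, Ψ]
    rw [hφ, hgs]
  rw [h5] at h4
  exact gaugeDeriv_eq (hf.contMDiffAt (hU.mem_nhds hgU)) h4 x

/-- For a right action, `(g · u) · v = g · (uv)`, so pulling `f` back along the orbit map of `g`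
turns gauge derivatives into left-invariant ones. In an iterated derivative the Hessian of the
pullback is symmetric and drops out of the commutator; the derivatives of `leftDeriv` left over form
the bracket. -/
theorem gaugeDeriv_lie [CompleteSpace E] {f : (Edge → G) → ℂ} {U : Set (Edge → G)} (hU : IsOpen U)
    (hf : ContMDiffOn (powModel E Edge) 𝓘(ℂ, ℂ) ω f U) {g : Edge → G} (hg : g ∈ U)
    (a b : HalfEdge Edge → LieAlg E G) :
    gaugeDeriv (fun q => gaugeDeriv f q a) g b - gaugeDeriv (fun q => gaugeDeriv f q b) g a =
      gaugeDeriv f g (fun j => ⁅b j, a j⁆) := by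
  set o : HalfEdge Edge → E := powOrigin E G _
  set F : (HalfEdge Edge → E) → ℂ := fun u => f (gaugeAction g (powSymm E u)) with hFdef
  have hfU : ∀ q ∈ U, ContMDiffAt (powModel E Edge) 𝓘(ℂ, ℂ) ω f q := fun q hq =>
    hf.contMDiffAt (hU.mem_nhds hq)
  have hF : ContDiffAt ℂ ω F o := contDiffAt_gaugeAction (hfU g hg)
  let dl := fderiv ℂ (leftDeriv E G) (origin E G)
  have hdl : HasFDerivAt (leftDeriv E G) dl (origin E G) :=
    (contDiffAt_leftDeriv.differentiableAt (by simp)).hasFDerivAt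
  have hmem : ∀ᶠ u in nhds o, gaugeAction g (powSymm E u) ∈ U := by
    have h1 := (contMDiffAt_gaugeAction_powSymm (X := HalfEdge Edge → E) (p := fun _ => g)
      (u := fun u => u) (x := o) (contMDiffAt_const (I' := powModel E Edge)) contDiffAt_id rfl).continuousAt
    refine h1.preimage_mem_nhds ?_
    rw [powSymm_origin, gaugeAction_one]
    exact hU.mem_nhds hg
  have happly : ∀ α : HalfEdge Edge, Filter.Tendsto (fun u : HalfEdge Edge → E => u α) (nhds o)
      (nhds (origin E G)) := fun α => (continuous_apply α).continuousAt
  -- The first derivative is needed at all points of the orbit near `g`, since it is differentiated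
  -- once more in `hsecond`.
  have hfirst : ∀ c : HalfEdge Edge → E, (fun u => gaugeDeriv (E := E) f (gaugeAction g (powSymm E u)) c)
      =ᶠ[nhds o] fun u => fderiv ℂ F u (fun α => leftDeriv E G (u α) (c α)) := by
    intro c
    have h1 : ∀ᶠ u in nhds o, ∀ α, u α ∈ (chart E G).target ∧
        ContDiffAt ℂ ω (mul E G) (u α, origin E G) ∧
        ∀ᶠ y in nhds (origin E G), (chart E G).symm (mul E G (u α, y)) =
          (chart E G).symm (u α) * (chart E G).symm y :=
      Filter.eventually_all.2 fun α => (happly α).eventually (eventually_mem_target.and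
        (eventually_contDiffAt_mul_left.and eventually_symm_mul.curry_nhds))
    filter_upwards [h1, hmem, hF.eventually (by simp)] with u hu huU hFu
    have h2 : HasFDerivAt (fun (v : HalfEdge Edge → E) α => mul E G (u α, v α))
        (ContinuousLinearMap.pi fun α => leftDeriv E G (u α) ∘L ContinuousLinearMap.proj α) o := by
      refine hasFDerivAt_pi.2 fun α => ?_
      have h3 : HasFDerivAt (fun v => mul E G (u α, v)) (leftDeriv E G (u α)) (o α) := by
        refine DifferentiableAt.hasFDerivAt ?_
        exact ((hu α).2.1.differentiableAt (by simp)).comp (f := fun v => (u α, v)) (origin E G)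
          (hasFDerivAt_prodMk_right _ _).differentiableAt
      exact h3.comp o (hasFDerivAt_apply (𝕜 := ℂ) α o)
    have h4 : (fun α => mul E G (u α, o α)) = u := funext fun α => mul_origin_right (hu α).1
    have h5 : HasFDerivAt F (fderiv ℂ F u) (fun α => mul E G (u α, o α)) := by
      rw [h4]
      exact (hFu.differentiableAt (by simp)).hasFDerivAt
    have h6 : (fun v => f (gaugeAction (gaugeAction g (powSymm E u)) (powSymm E v))) =ᶠ[nhds o]
        F ∘ fun v α => mul E G (u α, v α) := by
      have h7 : ∀ᶠ v in nhds o, ∀ α, (chart E G).symm (mul E G (u α, v α)) =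
          (chart E G).symm (u α) * (chart E G).symm (v α) :=
        Filter.eventually_all.2 fun α => (happly α).eventually (hu α).2.2
      filter_upwards [h7] with v hv
      simp only [Function.comp_apply, hFdef]
      congr 1
      funext γ
      simp only [gaugeAction, powSymm, hv, mul_inv_rev]
      group
    have h8 := (h5.comp o h2).congr_of_eventuallyEq h6
    exact gaugeDeriv_eq (hfU _ huU) h8 c
  have hsecond : ∀ c d : HalfEdge Edge → E,
      gaugeDeriv (E := E) (fun q => gaugeDeriv (E := E) f q c) g d =
        fderiv ℂ (fderiv ℂ F) o d c + fderiv ℂ F o (fun α => dl (d α) (c α)) := by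
    intro c d
    have h1 : HasFDerivAt (fderiv ℂ F) (fderiv ℂ (fderiv ℂ F) o) o :=
      ((hF.fderiv_right (m := ω) (by simp)).differentiableAt (by simp)).hasFDerivAt
    have h2 : HasFDerivAt (fun (u : HalfEdge Edge → E) α => leftDeriv E G (u α) (c α))
        (ContinuousLinearMap.pi fun α =>
          (dl.flip (c α)) ∘L ContinuousLinearMap.proj α) o := by
      refine hasFDerivAt_pi.2 fun α => ?_
      have h3 : HasFDerivAt (fun u => leftDeriv E G u (c α)) (dl.flip (c α)) (o α) := by
        refine (hdl.clm_apply (hasFDerivAt_const (c α) (origin E G))).congr_fderiv ?_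
        ext y
        simp
      exact h3.comp o (hasFDerivAt_apply (𝕜 := ℂ) α o)
    have h4 := (h1.clm_apply h2).congr_of_eventuallyEq (hfirst c)
    have h5 := gaugeDeriv_eq ((contMDiffOn_gaugeDeriv hU hf c).contMDiffAt (hU.mem_nhds hg)) h4 d
    refine h5.trans ?_
    have h6 : (fun α => leftDeriv E G (o α) (c α)) = c := by
      funext α
      exact DFunLike.congr_fun leftDeriv_origin (c α)
    rw [h6]
    simp only [add_apply, ContinuousLinearMap.comp_apply,
      ContinuousLinearMap.flip_apply]
    exact add_comm _ _
  have hsymm : fderiv ℂ (fderiv ℂ F) o b a = fderiv ℂ (fderiv ℂ F) o a b :=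
    (hF.isSymmSndFDerivAt (by simp)).eq _ _
  have hlast : gaugeDeriv f g (fun j => ⁅b j, a j⁆) =
      fderiv ℂ F o (fun α => dl (b α) (a α)) - fderiv ℂ F o (fun α => dl (a α) (b α)) := by
    rw [gaugeDeriv_eq (hfU g hg) (hasFDerivAt_gaugeAction (hfU g hg)), ← map_sub]
    refine congrArg (fderiv ℂ F o) (funext fun α => ?_)
    exact lie_eq_sub (b α) (a α)
  have e1 := hsecond a b
  have e2 := hsecond b a
  refine (congrArg₂ (· - ·) e1 e2).trans ?_
  rw [hlast, hsymm]
  ring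

end Gauge

/-! ### The Poisson structure. -/

theorem theorem4p2
    {E : Type*} [NormedAddCommGroup E] [NormedSpace ℂ E] [FiniteDimensional ℂ E]
    {G : Type*} [TopologicalSpace G] [ChartedSpace E G] [Group G] [LieGroup 𝓘(ℂ, E) ω G]
    [ConnectedSpace G]
    {V Edge : Type*} [Fintype V] [DecidableEq V] [Fintype Edge] [DecidableEq Edge]
    (Γ : OrientedCiliatedGraph V Edge)
    (s : LieAlg E G ⊗[ℂ] LieAlg E G) (Λ : V → LieAlg E G ⊗[ℂ] LieAlg E G)
    (hr : ∀ v, RMatrix.IsQuasitriangular s (Λ v)) :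
    IsPoissonStructure (powModel E Edge) (M := Edge → G)
      (gaugeTensor E G (Γ.rMatrix s Λ)) := by
  set r := Γ.rMatrix s Λ with hrdef
  have hzero : ∀ g, gaugeTensor E G r g +
      TensorProduct.comm ℂ _ _ (gaugeTensor E G r g) = 0 := by
    intro g
    -- Symmetry and invariance of `s` come from the hypothesis at some vertex; without vertices `r`
    -- is an empty sum.
    rcases isEmpty_or_nonempty V with hV | ⟨⟨v⟩⟩
    · have h : r = 0 := by rw [hrdef, OrientedCiliatedGraph.rMatrix, Finset.univ_eq_empty,
        Finset.sum_empty]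
      rw [h, gaugeTensor, map_zero, map_zero, add_zero]
    · refine (TensorProduct.map_self_add_comm (gaugeField E G g) r).trans ?_
      refine (congrArg _ (Γ.rMatrix_add_comm (hr v).symm fun v => (hr v).skew)).trans ?_
      exact TensorProduct.map_smul_sum_sub_eq_zero _ _ _ fun γ =>
        gaugeTensor_source_eq_target (hr v).invariant g γ
  have hskew : ∀ g, TensorProduct.comm ℂ (TangentSpace (powModel E Edge) g)
      (TangentSpace (powModel E Edge) g) (gaugeTensor E G r g) = -gaugeTensor E G r g :=
    fun g => eq_neg_of_add_eq_zero_right (hzero g)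
  have hbracket : ∀ (f h : (Edge → G) → ℂ) g, tensorBracket (powModel E Edge) (gaugeTensor E G r) f h g =
      -tensorBracket (powModel E Edge) (gaugeTensor E G r) h f g := by
    intro f h g
    exact TensorProduct.mul'_map_of_comm_eq_neg _ _ (hskew g)
  have hmul : ∀ (U : Set (Edge → G)) (f h : (Edge → G) → ℂ),
      ContMDiffOn (powModel E Edge) 𝓘(ℂ, ℂ) ω f U → ContMDiffOn (powModel E Edge) 𝓘(ℂ, ℂ) ω h U →
      ContMDiffOn (powModel E Edge) 𝓘(ℂ, ℂ) ω (fun g => f g * h g) U :=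
    fun U f h hf hh => hf.mul hh
  refine ⟨hskew, ?_, ?_⟩
  · intro U hU f h hf hh
    obtain ⟨S, hS⟩ := TensorProduct.exists_finset r
    have h1 : tensorBracket (powModel E Edge) (gaugeTensor E G r) f h =
        fun g => ∑ i ∈ S, gaugeDeriv (E := E) f g i.1 * gaugeDeriv (E := E) h g i.2 := by
      funext g
      rw [tensorBracket_gaugeTensor, hS]
      simp
    rw [h1]
    exact contMDiffOn_finsetSum fun i _ => hmul _ _ _ (contMDiffOn_gaugeDeriv hU hf _)
      (contMDiffOn_gaugeDeriv hU hh _)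
  · intro U hU f h k hf hh hk g hg
    exact RMatrix.jacobi_of_yangBaxterForm r (gaugeDeriv (E := E))
      (fun f => ContMDiffOn (powModel E Edge) 𝓘(ℂ, ℂ) ω f U) U
      (fun f hf a => contMDiffOn_gaugeDeriv hU hf a) (hmul U)
      (fun S F hF p hp => gaugeDeriv_sum S fun i => (hF i).contMDiffAt (hU.mem_nhds hp))
      (fun f p _ => gaugeDeriv_neg f p)
      (fun f h hf hh p hp => gaugeDeriv_mul (hf.contMDiffAt (hU.mem_nhds hp))
        (hh.contMDiffAt (hU.mem_nhds hp)))
      (fun f hf p hp a b => gaugeDeriv_lie hU hf hp a b) _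
      (tensorBracket_gaugeTensor r) hbracket (Γ.yangBaxterForm_rMatrix hr) hf hh hk hg
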